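/- **Setting.** Let $M,d\ge 1$, let $\|\cdot\|$ be any norm on $(\mathbb R^{d})^M=\mathbb R^{Md}$ and let $L>0$. There are $M$ players. In each round every player picks an action in $[0,1]^d$, without communication; together they pull a joint arm $a=(a_1,\dots,a_M)\in([0,1]^d)^M$. Each joint arm $a$ has a reward distribution $\nu_a$ on $\mathbb R$ with mean $\mu_a\in[0,1]$ that is $1$-subgaussian about its mean (for instance any distribution on $[0,1]$), and $|\mu_a-\mu_b|\le L\|a-b\|$ for all $a,b$. Conditionally on the past rewards, the reward $X_t$ of round $t$ has distribution $\nu_{a_t}$, where $a_t$ is the joint arm pulled in round $t$. There is information asymmetry in actions: all players observe the same reward $X_t$, but no player observes the actions of the other players. Put $\mu^*=\sup_a\mu_a$, $\Delta_a=\mu^*-\mu_a$, and let the regret be $R(T)=T\mu^*-\sum_{t=1}^T\mathbb E[X_t]$. **Algorithm mZoom-A** (inputs: horizon $T$, $M$, $d$, $L$, $\|\cdot\|$). Joint arms are ordered lexicographically, by player and within a player by coordinate. Every player privately keeps a finite set $\mathcal A$ of active joint arms, a dyadic grid $\{k/2^n:0\le k\le 2^n\}^{Md}$, and, for each joint arm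 $a$, the number $n_a$ of rounds in which the player inferred that $a$ was pulled and the empirical mean $\hat\mu_a$ of the rewards received in these rounds. Let $\varepsilon_a=\sqrt{6\log T/n_a}$, with $\varepsilon_a=\infty$ if $n_a=0$. Initially $\mathcal A=\{(\tfrac12,\dots,\tfrac12)\}$ and $n=1$. In each round $1,\dots,T$, every player does the following. 1. If some point of $[0,1]^{Md}$ lies in none of the closed balls of radius $\varepsilon_a/L$ about the arms $a\in\mathcal A$, increase $n$ by $1$ repeatedly until the grid contains an uncovered point (not at all if it already does), and add the smallest uncovered grid point to $\mathcal A$. At most one arm is added per round. 2. Find the arm $a\in\mathcal A$ with the largest index $\hat\mu_a+2\varepsilon_a$, the smallest such arm in case of a tie. Infer that this joint arm is pulled; player $i$ plays its $i$-th component. 3. Receive the reward of the round and update $n_a$ and $\hat\mu_a$ for this arm $a$. **Multiplier.** For a set $S$ of joint arms let $N_\rho(S)$ be the smallest number of sets of $\|\cdot\|$-diameter at most $\rho$ that cover $S$. A number $c$ is called a *multiplier* if $$N_{r/(3L)}\bigl(\{a\in([0,1]^d)^M: r\le\Delta_a<2r\}\bigr)\le \frac{c}{r^{Md}}\qquad\text{for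 all } r>0 .$$ **Theorem.** If all players run mZoom-A, then the regret satisfies $$R(T)=O\Bigl(T^{\frac{Md+1}{Md+2}}\,(c\log T)^{\frac1{Md+2}}\Bigr).$$ More precisely, there is an absolute constant $K>0$ such that for all $M$, $d$, $L$, $\|\cdot\|$ and $(\nu_a)$ as above, every multiplier $c$ and every horizon $T\ge 2$, the rewards $X_1,\dots,X_T$ are integrable and $$R(T)\le K\,T^{\frac{Md+1}{Md+2}}\,(c\log T)^{\frac1{Md+2}} .$$ -/

import Mathlib

open MeasureTheory ProbabilityTheory

noncomputable section

/-! ### The action space -/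

/-- A joint arm of `M` players with `d`-dimensional individual actions; `a i` is the action of
player `i`. The actual arms are the points of `cube M d`. -/
abbrev JointArm (M d : ℕ) : Type := Fin M → Fin d → ℝ

/-- The joint action space `([0,1]^d)^M`. -/
def cube (M d : ℕ) : Set (JointArm M d) := {a | ∀ i j, a i j ∈ Set.Icc (0 : ℝ) 1}

/-- The dyadic discretization of level `n`: all joint arms with coordinates `k / 2^n`,
`0 ≤ k ≤ 2^n`. Doubling the grid replaces `n` by `n + 1`. -/
def dyadicGrid (M d n : ℕ) : Finset (JointArm M d) :=
  Fintype.piFinset fun _ => Fintype.piFinset fun _ =>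
    (Finset.range (2 ^ n + 1)).image fun k : ℕ => (k : ℝ) / 2 ^ n

/-- The key by which joint arms are ordered: lexicographically by player, and within a player
lexicographically by coordinate. On every grid this is the order of the base-`K` numbers whose
`i`-th digit is the number of the action of player `i`. -/
def lexKey {M d : ℕ} (a : JointArm M d) : Lex (Fin M → Lex (Fin d → ℝ)) :=
  toLex fun i => toLex (a i)

open Classical in
/-- The smallest arm of a finite set of joint arms (the default value is never used on a
nonempty set). -/
def leastArm {M d : ℕ} (S : Finset (JointArm M d)) : JointArm M d :=
  if h : S.Nonempty then (S.exists_min_image lexKey h).choose else 0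

/-! ### The algorithm -/

/-- The private memory of one player: the set of active joint arms, the level of the current
grid, and the record of the joint arms which the player inferred to have been pulled, each with
the reward that the player received in that round. -/
structure ZoomState (M d : ℕ) where
  active : Finset (JointArm M d)
  level : ℕ
  record : List (JointArm M d × ℝ)

namespace ZoomState

variable {M d : ℕ}

/-- At the start only `(1/2, …, 1/2)` is active, and the grid is the coarsest dyadic grid that
contains it. -/
def init (M d : ℕ) : ZoomState M d where
  active := {fun _ _ => 1 / 2}
  level := 1
  record := []

open Classical in
/-- The rewards recorded for the joint arm `a`. -/
def rewards (s : ZoomState M d) (a : JointArm M d) : List ℝ :=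
  (s.record.filter fun p => p.1 = a).map Prod.snd

/-- The number `n_a` of recorded pulls of `a`. -/
def pulls (s : ZoomState M d) (a : JointArm M d) : ℕ := (s.rewards a).length

/-- The empirical mean of `a` (used only if `a` has been pulled). -/
def empMean (s : ZoomState M d) (a : JointArm M d) : ℝ := (s.rewards a).sum / s.pulls a

/-- The confidence width `ε_a = √(6 log T / n_a)` (used only if `a` has been pulled; it is
infinite otherwise, see `ucb` and `Covers`). -/
def width (T : ℕ) (s : ZoomState M d) (a : JointArm M d) : ℝ :=
  √(6 * Real.log T / s.pulls a)

/-- The index `μ̂_a + 2 ε_a`, which is `+∞` for an arm that has not been pulled. -/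
def ucb (T : ℕ) (s : ZoomState M d) (a : JointArm M d) : EReal :=
  if s.pulls a = 0 then ⊤ else ((s.empMean a + 2 * s.width T a : ℝ) : EReal)

/-- `x` lies in the closed ball about `a` with radius `ε_a / L`; this radius is `+∞` if `a` has
not been pulled. -/
def Covers (T : ℕ) (L : ℝ) (nrm : Seminorm ℝ (JointArm M d)) (s : ZoomState M d)
    (a x : JointArm M d) : Prop :=
  s.pulls a = 0 ∨ nrm (x - a) ≤ s.width T a / L

/-- The part of the action space that the balls of the active arms leave uncovered. -/
def uncovered (T : ℕ) (L : ℝ) (nrm : Seminorm ℝ (JointArm M d)) (s : ZoomState M d) :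
    Set (JointArm M d) :=
  {x ∈ cube M d | ∀ a ∈ s.active, ¬ s.Covers T L nrm a x}

open Classical in
/-- The activation step: if something is uncovered, double the grid until one of its points is
uncovered (not at all if that is so already), and activate the smallest uncovered grid point. -/
def activate (T : ℕ) (L : ℝ) (nrm : Seminorm ℝ (JointArm M d)) (s : ZoomState M d) :
    ZoomState M d :=
  if (s.uncovered T L nrm).Nonempty then
    let n := sInf {n | s.level ≤ n ∧ ∃ x ∈ dyadicGrid M d n, x ∈ s.uncovered T L nrm}
    { s with
      active := insert
        (leastArm ((dyadicGrid M d n).filter fun x => x ∈ s.uncovered T L nrm)) s.active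
      level := n }
  else s

open Classical in
/-- The active arm with the largest index; the smallest such arm in case of a tie. -/
def choice (T : ℕ) (s : ZoomState M d) : JointArm M d :=
  leastArm (s.active.filter fun a => ∀ b ∈ s.active, s.ucb T b ≤ s.ucb T a)

/-- One complete round in the memory of a player who receives the reward `x` in it. -/
def step (T : ℕ) (L : ℝ) (nrm : Seminorm ℝ (JointArm M d)) (s : ZoomState M d) (x : ℝ) :
    ZoomState M d :=
  let s' := s.activate T L nrm
  { s' with record := (s'.choice T, x) :: s'.record }

/-- The memory of a player who has received the rewards `obs` (in chronological order). -/
def run (T : ℕ) (L : ℝ) (nrm : Seminorm ℝ (JointArm M d)) (obs : List ℝ) : ZoomState M d :=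
  obs.foldl (step T L nrm) (init M d)

end ZoomState

/-- What player `i` plays with the algorithm `mZoom-A` (horizon `T`) after having received the
rewards `obs`: the own component of the joint arm that the player's memory singles out. The
actions of the other players are not an argument. -/
def playerAction {M d : ℕ} (T : ℕ) (L : ℝ) (nrm : Seminorm ℝ (JointArm M d)) (i : Fin M)
    (obs : List ℝ) : Fin d → ℝ :=
  (((ZoomState.run T L nrm obs).activate T L nrm).choice T) i

/-- The joint arm that results when each player `i` has received the rewards `obs i`. -/
def jointAction {M d : ℕ} (T : ℕ) (L : ℝ) (nrm : Seminorm ℝ (JointArm M d))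
    (obs : Fin M → List ℝ) : JointArm M d :=
  fun i => playerAction T L nrm i (obs i)

/-! ### The environment -/

/-- The mean reward of the joint arm `a` if `ν a` is its reward distribution. -/
def meanReward {M d : ℕ} (ν : JointArm M d → Measure ℝ) (a : JointArm M d) : ℝ :=
  ∫ x, x ∂(ν a)

/-- The optimal mean `μ*`. -/
def optMean {M d : ℕ} (ν : JointArm M d → Measure ℝ) : ℝ := sSup (meanReward ν '' cube M d)

/-- The gap `Δ_a = μ* - μ_a`. -/
def gap {M d : ℕ} (ν : JointArm M d → Measure ℝ) (a : JointArm M d) : ℝ :=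
  optMean ν - meanReward ν a

/-- `ν` assigns to the joint arms `1`-subgaussian reward distributions with means in `[0,1]`
which are `L`-Lipschitz in the arm. -/
structure IsLipschitzBandit {M d : ℕ} (L : ℝ) (nrm : Seminorm ℝ (JointArm M d))
    (ν : JointArm M d → Measure ℝ) : Prop where
  prob : ∀ a ∈ cube M d, IsProbabilityMeasure (ν a)
  subgaussian : ∀ a ∈ cube M d, HasSubgaussianMGF (fun x => x - meanReward ν a) 1 (ν a)
  mean_mem : ∀ a ∈ cube M d, meanReward ν a ∈ Set.Icc (0 : ℝ) 1
  lipschitz : ∀ a ∈ cube M d, ∀ b ∈ cube M d,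
    |meanReward ν a - meanReward ν b| ≤ L * nrm (a - b)

/-- The rewards of the rounds `0, …, t - 1`, in chronological order. -/
def pastRewards {Ω : Type*} (X : ℕ → Ω → ℝ) (t : ℕ) (ω : Ω) : List ℝ :=
  List.ofFn fun s : Fin t => X s ω

/-- The joint arm pulled in round `t` (rounds are numbered from `0`) when all players run
`mZoom-A` and all of them receive the same rewards `X 0, X 1, …`. -/
def armAt {Ω : Type*} {M d : ℕ} (T : ℕ) (L : ℝ) (nrm : Seminorm ℝ (JointArm M d))
    (X : ℕ → Ω → ℝ) (t : ℕ) (ω : Ω) : JointArm M d :=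
  jointAction T L nrm fun _ => pastRewards X t ω

/-- `X 0, …, X (T - 1)` are the rewards which the players all receive when they run `mZoom-A`
in the environment `ν`: conditionally on the past, `X t` has the distribution of the joint arm
pulled in round `t`. -/
structure IsRewardProcess {Ω : Type*} [MeasurableSpace Ω] (P : Measure Ω) {M d : ℕ} (T : ℕ)
    (L : ℝ) (nrm : Seminorm ℝ (JointArm M d)) (ν : JointArm M d → Measure ℝ)
    (X : ℕ → Ω → ℝ) : Prop where
  measurable : ∀ t < T, Measurable (X t)
  cond_law : ∀ t < T, ∀ (C : Set (Fin t → ℝ)) (B : Set ℝ), MeasurableSet C → MeasurableSet B →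
    P {ω | (fun s : Fin t => X s ω) ∈ C ∧ X t ω ∈ B} =
      ∫⁻ ω in {ω | (fun s : Fin t => X s ω) ∈ C}, ν (armAt T L nrm X t ω) B ∂P

/-- The regret `R_T = T μ* - ∑ E[X_t]`. -/
def regret {Ω : Type*} [MeasurableSpace Ω] (P : Measure Ω) {M d : ℕ} (T : ℕ)
    (ν : JointArm M d → Measure ℝ) (X : ℕ → Ω → ℝ) : ℝ :=
  T * optMean ν - ∑ t ∈ Finset.range T, ∫ ω, X t ω ∂P

/-! ### The zooming multiplier -/

/-- `S` can be covered by `k` sets of diameter at most `ρ`, that is, the covering number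
`N_ρ(S)` is at most `k`. -/
def CoveredBy {M d : ℕ} (nrm : Seminorm ℝ (JointArm M d)) (ρ : ℝ) (S : Set (JointArm M d))
    (k : ℕ) : Prop :=
  ∃ U : Fin k → Set (JointArm M d),
    (∀ i, ∀ x ∈ U i, ∀ y ∈ U i, nrm (x - y) ≤ ρ) ∧ S ⊆ ⋃ i, U i

/-- `c` is a multiplier for the exponent `M d`: for every `r > 0` the set of the arms with
`r ≤ Δ_a < 2 r` satisfies `N_{r/(3L)} ≤ c / r^(M d)`. -/
def IsZoomingMultiplier {M d : ℕ} (L : ℝ) (nrm : Seminorm ℝ (JointArm M d))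
    (ν : JointArm M d → Measure ℝ) (c : ℝ) : Prop :=
  ∀ r : ℝ, 0 < r → ∃ k : ℕ,
    CoveredBy nrm (r / (3 * L)) {a ∈ cube M d | r ≤ gap ν a ∧ gap ν a < 2 * r} k ∧
      (k : ℝ) ≤ c / r ^ (M * d)

end

noncomputable section

/-! ### The action space -/

/-! All players see the same rewards and run the same deterministic rule, so their private memories
coincide and the inferred arm is the pulled one (`armAt_eq_pulledArm`). What remains is the analysis
of single-agent zooming in dimension `M * d`.

Deterministic part, assuming that all empirical means are within their widths (`IsClean`). The balls
of the active arms cover the cube, so by the Lipschitz condition the largest index dominates `μ*`,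
and a pulled arm has gap at most three widths (`IsClean.gap_le`). Hence an arm of gap `Δ` is pulled
`O(log T / Δ ^ 2)` times (`IsClean.pulls_mul_sq_gap_le`). Equivalently, its ball never gets smaller
than order `Δ / L`, which keeps active arms of comparable gap apart (`IsClean.lt_dist`), and the
multiplier bounds their number (`IsClean.card_slice_le`). Summing over a geometric sequence of gap
scales above a threshold `δ` gives regret `O(δ T + c log T / δ ^ (M d + 1))` (`IsClean.sum_gap_le`),
and the final choice of `δ` balances the two terms.

Probabilistic part. The arms form a continuum, so the union bound runs over the round `k` of an
arm's first pull, the number `n` of its pulls, and a sign. For each triple an exponential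
supermartingale (`IsRewardProcess.lintegral_exp_weightedSum_le`) and Markov's inequality give
probability at most `T⁻³`, in total at most `2 / T`
(`IsRewardProcess.exists_measurableSet_isClean`).

No measurability of `ν` in the arm is assumed. It is not needed, because the arm of a given round
takes only finitely many values (`isSimple_pulledArm`). -/

theorem leastArm_mem {M d : ℕ} {S : Finset (JointArm M d)} (h : S.Nonempty) : leastArm S ∈ S := by
  rw [leastArm, dif_pos h]
  exact (S.exists_min_image lexKey h).choose_spec.1

theorem Seminorm.continuous_of_finite {M d : ℕ} (nrm : Seminorm ℝ (JointArm M d)) :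
    Continuous nrm := by
  rw [← continuousOn_univ]
  exact ConvexOn.continuousOn isOpen_univ nrm.convexOn

theorem mem_dyadicGrid {M d n : ℕ} {a : JointArm M d} :
    a ∈ dyadicGrid M d n ↔ ∀ i j, ∃ k : ℕ, k ≤ 2 ^ n ∧ (k : ℝ) / 2 ^ n = a i j := by
  simp [dyadicGrid, Fintype.mem_piFinset]

theorem dyadicGrid_subset_cube {M d n : ℕ} {a : JointArm M d} (h : a ∈ dyadicGrid M d n) :
    a ∈ cube M d := by
  intro i j
  obtain ⟨k, hk, h⟩ := mem_dyadicGrid.1 h i j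
  rw [← h]
  refine ⟨by positivity, ?_⟩
  rw [div_le_one (by positivity)]
  exact_mod_cast hk

/-- The point of the grid of level `n` just below `y`. -/
def dyadicFloor {M d : ℕ} (y : JointArm M d) (n : ℕ) : JointArm M d :=
  fun i j => (⌊y i j * 2 ^ n⌋₊ : ℝ) / 2 ^ n

theorem dyadicFloor_mem {M d : ℕ} {y : JointArm M d} (hy : y ∈ cube M d) (n : ℕ) :
    dyadicFloor y n ∈ dyadicGrid M d n := by
  rw [mem_dyadicGrid]
  intro i j
  refine ⟨⌊y i j * 2 ^ n⌋₊, ?_, rfl⟩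
  apply Nat.floor_le_of_le
  have := (hy i j).2
  push_cast
  exact mul_le_of_le_one_left (by positivity) this

theorem tendsto_dyadicFloor {M d : ℕ} {y : JointArm M d} (hy : y ∈ cube M d) :
    Filter.Tendsto (dyadicFloor y) Filter.atTop (nhds y) := by
  rw [tendsto_pi_nhds]
  intro i
  rw [tendsto_pi_nhds]
  intro j
  exact (tendsto_nat_floor_mul_div_atTop (hy i j).1).comp
    (tendsto_pow_atTop_atTop_of_one_lt (one_lt_two (α := ℝ)))

/-! ### Rounds of the algorithm -/

namespace ZoomState

variable {M d : ℕ} {T : ℕ} {L : ℝ} {nrm : Seminorm ℝ (JointArm M d)} {s : ZoomState M d}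

/-- The invariants of the memory of a player. -/
structure Valid (s : ZoomState M d) : Prop where
  nonempty : s.active.Nonempty
  mem_cube : ∀ a ∈ s.active, a ∈ cube M d
  mem_active : ∀ a, s.pulls a ≠ 0 → a ∈ s.active

theorem record_activate : (s.activate T L nrm).record = s.record := by
  unfold activate; split_ifs <;> rfl

theorem rewards_activate (a : JointArm M d) :
    (s.activate T L nrm).rewards a = s.rewards a := by
  simp only [rewards, record_activate]

theorem pulls_activate (a : JointArm M d) : (s.activate T L nrm).pulls a = s.pulls a := by
  simp only [pulls, rewards_activate]

theorem width_activate (a : JointArm M d) : (s.activate T L nrm).width T a = s.width T a := by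
  simp only [width, pulls_activate]

theorem empMean_activate (a : JointArm M d) : (s.activate T L nrm).empMean a = s.empMean a := by
  simp only [empMean, pulls_activate, rewards_activate]

theorem ucb_activate (a : JointArm M d) : (s.activate T L nrm).ucb T a = s.ucb T a := by
  simp only [ucb, pulls_activate, width_activate, empMean_activate]

theorem width_nonneg (a : JointArm M d) : 0 ≤ s.width T a := Real.sqrt_nonneg _

theorem covers_self (hL : 0 < L) (a : JointArm M d) : s.Covers T L nrm a a := by
  right
  rw [sub_self, map_zero]
  exact div_nonneg (width_nonneg a) hL.le

/-- Being uncovered is stable under small perturbations within the cube: finitely many closed balls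
have to be avoided and the norm is continuous. The dyadic approximations of an uncovered point are
therefore eventually uncovered, so the search for a grid level terminates. -/
theorem exists_uncovered_grid (h : (s.uncovered T L nrm).Nonempty) :
    ∃ n, s.level ≤ n ∧ ∃ x ∈ dyadicGrid M d n, x ∈ s.uncovered T L nrm := by
  obtain ⟨y, hy, hcov⟩ := h
  have hev : ∀ᶠ n in Filter.atTop, ∀ a ∈ s.active, ¬ s.Covers T L nrm a (dyadicFloor y n) := by
    rw [Finset.eventually_all]
    intro a ha
    have h := hcov a ha
    simp only [Covers, not_or, not_le] at h ⊢
    have ht : Filter.Tendsto (fun n => nrm (dyadicFloor y n - a)) Filter.atTop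
        (nhds (nrm (y - a))) :=
      (nrm.continuous_of_finite.tendsto _).comp ((tendsto_dyadicFloor hy).sub_const a)
    filter_upwards [ht.eventually (lt_mem_nhds h.2)] with n hn using ⟨h.1, hn⟩
  obtain ⟨n, hn, hle⟩ := (hev.and (Filter.eventually_ge_atTop s.level)).exists
  exact ⟨n, hle, _, dyadicFloor_mem hy n, dyadicGrid_subset_cube (dyadicFloor_mem hy n), hn⟩

/-- The activation step either changes nothing, or it activates one uncovered arm. -/
theorem activate_cases (T : ℕ) (L : ℝ) (nrm : Seminorm ℝ (JointArm M d)) (s : ZoomState M d) :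
    (s.uncovered T L nrm = ∅ ∧ (s.activate T L nrm).active = s.active) ∨
      ∃ b ∈ s.uncovered T L nrm, (s.activate T L nrm).active = insert b s.active := by
  classical
  rcases (s.uncovered T L nrm).eq_empty_or_nonempty with h | h
  · left
    simp [activate, h]
  · right
    rw [activate, if_pos h]
    obtain ⟨-, x, hx, hu⟩ := Nat.sInf_mem (exists_uncovered_grid h)
    refine ⟨_, (Finset.mem_filter.1 (leastArm_mem ⟨x, Finset.mem_filter.2 ⟨hx, hu⟩⟩)).2, ?_⟩
    congr!

theorem Valid.activate (h : s.Valid) : (s.activate T L nrm).Valid := by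
  classical
  rcases activate_cases T L nrm s with ⟨-, he⟩ | ⟨b, hb, he⟩
  · refine ⟨he ▸ h.nonempty, he ▸ h.mem_cube, fun a ha => ?_⟩
    rw [pulls_activate] at ha
    exact he ▸ h.mem_active a ha
  · refine ⟨he ▸ Finset.insert_nonempty _ _, fun a ha => ?_, fun a ha => ?_⟩
    · rw [he, Finset.mem_insert] at ha
      rcases ha with rfl | ha
      exacts [hb.1, h.mem_cube a ha]
    · rw [pulls_activate] at ha
      exact he ▸ Finset.mem_insert_of_mem (h.mem_active a ha)

/-- After the activation step the confidence balls cover the action space. -/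
theorem Valid.exists_covers (h : s.Valid) (hL : 0 < L) {y : JointArm M d} (hy : y ∈ cube M d) :
    ∃ a ∈ (s.activate T L nrm).active, s.Covers T L nrm a y := by
  rcases activate_cases T L nrm s with ⟨hu, he⟩ | ⟨b, hb, he⟩
  · by_contra! hc
    have : y ∈ s.uncovered T L nrm := ⟨hy, by rwa [he] at hc⟩
    simp [hu] at this
  -- The new arm alone covers everything: it is unpulled, since a pulled arm is already active and
  -- covers itself. This is why one activation per round suffices.
  · refine ⟨b, by simp [he], Or.inl ?_⟩
    by_contra hp
    exact hb.2 b (h.mem_active b hp) (covers_self hL b)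

theorem choice_spec (h : s.active.Nonempty) :
    s.choice T ∈ s.active ∧ ∀ b ∈ s.active, s.ucb T b ≤ s.ucb T (s.choice T) := by
  classical
  obtain ⟨a, ha, hmax⟩ := s.active.exists_max_image (s.ucb T) h
  have := leastArm_mem (S := s.active.filter fun a => ∀ b ∈ s.active, s.ucb T b ≤ s.ucb T a)
    ⟨a, Finset.mem_filter.2 ⟨ha, hmax⟩⟩
  have h2 := Finset.mem_filter.1 this
  unfold choice
  convert h2

open Classical in
theorem rewards_step (x : ℝ) (a : JointArm M d) :
    (s.step T L nrm x).rewards a =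
      if (s.activate T L nrm).choice T = a then x :: s.rewards a else s.rewards a := by
  simp only [step, rewards, record_activate, List.filter_cons]
  split_ifs <;> simp_all

open Classical in
theorem pulls_step (x : ℝ) (a : JointArm M d) :
    (s.step T L nrm x).pulls a =
      s.pulls a + if (s.activate T L nrm).choice T = a then 1 else 0 := by
  rw [pulls, rewards_step]
  split_ifs <;> simp [pulls]

open Classical in
theorem rewards_sum_step (x : ℝ) (a : JointArm M d) :
    ((s.step T L nrm x).rewards a).sum =
      (s.rewards a).sum + if (s.activate T L nrm).choice T = a then x else 0 := by
  rw [rewards_step]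
  split_ifs <;> simp [add_comm]

theorem Valid.step (h : s.Valid) (x : ℝ) : (s.step T L nrm x).Valid := by
  classical
  have h' := h.activate (T := T) (L := L) (nrm := nrm)
  refine ⟨h'.nonempty, h'.mem_cube, fun a ha => ?_⟩
  rw [pulls_step] at ha
  by_cases hc : (s.activate T L nrm).choice T = a
  · exact hc ▸ (choice_spec h'.nonempty).1
  · rw [if_neg hc, add_zero, ← pulls_activate (T := T) (L := L) (nrm := nrm)] at ha
    exact h'.mem_active a ha

theorem valid_init : (init M d).Valid := by
  refine ⟨Finset.singleton_nonempty _, fun a ha i j => ?_, fun a ha => ?_⟩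
  · rw [init, Finset.mem_singleton] at ha
    subst ha
    constructor <;> norm_num
  · simp [init, pulls, rewards] at ha

end ZoomState

/-! ### Trajectories -/

section Trajectory

variable {M d : ℕ} (T : ℕ) (L : ℝ) (nrm : Seminorm ℝ (JointArm M d))

/-- The memory before round `t` if the rewards are `x 0, x 1, …`. -/
def traj (x : ℕ → ℝ) (t : ℕ) : ZoomState M d :=
  ZoomState.run T L nrm (List.ofFn fun s : Fin t => x s)

/-- The arm pulled in round `t` if the rewards are `x 0, x 1, …`. -/
def pulledArm (x : ℕ → ℝ) (t : ℕ) : JointArm M d :=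
  ((traj T L nrm x t).activate T L nrm).choice T

/-- Coordination without communication: the components played by the separate players assemble to
the arm that a single central learner would pull. -/
theorem armAt_eq_pulledArm {Ω : Type*} (X : ℕ → Ω → ℝ) (t : ℕ) (ω : Ω) :
    armAt T L nrm X t ω = pulledArm T L nrm (fun s => X s ω) t := rfl

theorem traj_zero (x : ℕ → ℝ) : traj T L nrm x 0 = ZoomState.init M d := rfl

theorem traj_succ (x : ℕ → ℝ) (t : ℕ) :
    traj T L nrm x (t + 1) = (traj T L nrm x t).step T L nrm (x t) := by
  rw [traj, ZoomState.run, List.ofFn_succ', List.concat_eq_append, List.foldl_append]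
  rfl

theorem traj_congr {x y : ℕ → ℝ} {t : ℕ} (h : ∀ s < t, x s = y s) :
    traj T L nrm x t = traj T L nrm y t := by
  unfold traj
  congr 2
  funext s
  exact h s s.2

theorem pulledArm_congr {x y : ℕ → ℝ} {t : ℕ} (h : ∀ s < t, x s = y s) :
    pulledArm T L nrm x t = pulledArm T L nrm y t := by
  rw [pulledArm, pulledArm, traj_congr T L nrm h]

theorem valid_traj (x : ℕ → ℝ) (t : ℕ) : (traj T L nrm x t).Valid := by
  induction t with
  | zero => exact ZoomState.valid_init
  | succ t ih => rw [traj_succ]; exact ih.step _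

theorem pulledArm_mem_cube (x : ℕ → ℝ) (t : ℕ) : pulledArm T L nrm x t ∈ cube M d :=
  have h := (valid_traj T L nrm x t).activate (T := T) (L := L) (nrm := nrm)
  h.mem_cube _ (ZoomState.choice_spec h.nonempty).1

open Classical in
theorem pulls_traj_succ (x : ℕ → ℝ) (t : ℕ) (a : JointArm M d) :
    (traj T L nrm x (t + 1)).pulls a =
      (traj T L nrm x t).pulls a + if pulledArm T L nrm x t = a then 1 else 0 := by
  rw [traj_succ, ZoomState.pulls_step]; rfl

open Classical in
theorem pulls_traj (x : ℕ → ℝ) (t : ℕ) (a : JointArm M d) :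
    (traj T L nrm x t).pulls a =
      ∑ s ∈ Finset.range t, if pulledArm T L nrm x s = a then 1 else 0 := by
  induction t with
  | zero => simp [traj_zero, ZoomState.init, ZoomState.pulls, ZoomState.rewards]
  | succ t ih => rw [pulls_traj_succ, ih, Finset.sum_range_succ]

open Classical in
theorem rewards_sum_traj (x : ℕ → ℝ) (t : ℕ) (a : JointArm M d) :
    ((traj T L nrm x t).rewards a).sum =
      ∑ s ∈ Finset.range t, if pulledArm T L nrm x s = a then x s else 0 := by
  induction t with
  | zero => simp [traj_zero, ZoomState.init, ZoomState.rewards]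
  | succ t ih => rw [traj_succ, ZoomState.rewards_sum_step, ih, Finset.sum_range_succ]; rfl

theorem pulls_traj_mono (x : ℕ → ℝ) (a : JointArm M d) :
    Monotone fun t => (traj T L nrm x t).pulls a := by
  classical
  refine monotone_nat_of_le_succ fun t => ?_
  rw [pulls_traj_succ]
  exact Nat.le_add_right _ _

theorem pulls_traj_le (x : ℕ → ℝ) (t : ℕ) (a : JointArm M d) :
    (traj T L nrm x t).pulls a ≤ t := by
  classical
  rw [pulls_traj, Finset.sum_boole]
  simpa using Finset.card_filter_le (Finset.range t) _

theorem active_traj_succ (x : ℕ → ℝ) (t : ℕ) :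
    (traj T L nrm x (t + 1)).active = ((traj T L nrm x t).activate T L nrm).active := by
  rw [traj_succ]; rfl

theorem pulledArm_mem_active (x : ℕ → ℝ) (t : ℕ) :
    pulledArm T L nrm x t ∈ (traj T L nrm x (t + 1)).active := by
  rw [active_traj_succ]
  exact (ZoomState.choice_spec ((valid_traj T L nrm x t).activate).nonempty).1

end Trajectory

/-! ### The regret on the clean event -/

section Gap

variable {M d : ℕ} {L : ℝ} {nrm : Seminorm ℝ (JointArm M d)} {ν : JointArm M d → Measure ℝ}

theorem IsLipschitzBandit.bddAbove (hν : IsLipschitzBandit L nrm ν) :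
    BddAbove (meanReward ν '' cube M d) := by
  refine ⟨1, ?_⟩
  rintro _ ⟨a, ha, rfl⟩
  exact (hν.mean_mem a ha).2

theorem IsLipschitzBandit.gap_nonneg (hν : IsLipschitzBandit L nrm ν) {a : JointArm M d}
    (ha : a ∈ cube M d) : 0 ≤ gap ν a :=
  sub_nonneg.2 (le_csSup hν.bddAbove ⟨a, ha, rfl⟩)

theorem IsLipschitzBandit.gap_le_one (hν : IsLipschitzBandit L nrm ν) {a : JointArm M d}
    (ha : a ∈ cube M d) : gap ν a ≤ 1 := by
  have h1 : optMean ν ≤ 1 := by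
    refine csSup_le ⟨_, a, ha, rfl⟩ ?_
    rintro _ ⟨b, hb, rfl⟩
    exact (hν.mean_mem b hb).2
  have h2 := (hν.mean_mem a ha).1
  unfold gap
  linarith

theorem IsZoomingMultiplier.nonneg {c : ℝ} (hc : IsZoomingMultiplier L nrm ν c) : 0 ≤ c := by
  obtain ⟨k, -, hk⟩ := hc 1 one_pos
  rw [one_pow, div_one] at hk
  exact k.cast_nonneg.trans hk

/-- The slice with `r` equal to the gap of `a` contains `a`, so at least one covering set is needed.
-/
theorem IsZoomingMultiplier.gap_pow_le {c : ℝ} (hc : IsZoomingMultiplier L nrm ν c)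
    {a : JointArm M d} (ha : a ∈ cube M d) (h : 0 < gap ν a) : gap ν a ^ (M * d) ≤ c := by
  obtain ⟨k, ⟨U, -, hU⟩, hk⟩ := hc _ h
  have hk1 : 1 ≤ k := by
    have := hU ⟨ha, le_rfl, by linarith⟩
    obtain ⟨i, -⟩ := Set.mem_iUnion.1 this
    exact Nat.one_le_of_lt i.2
  have : (1 : ℝ) ≤ c / gap ν a ^ (M * d) := le_trans (by exact_mod_cast hk1) hk
  rwa [le_div_iff₀ (by positivity), one_mul] at this

end Gap

theorem one_le_two_mul_log {T : ℕ} (hT : 2 ≤ T) : 1 ≤ 2 * Real.log T := by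
  have h1 := Real.log_two_gt_d9
  have h2 : Real.log 2 ≤ Real.log T := Real.log_le_log two_pos (by exact_mod_cast hT)
  linarith

/-- All empirical means that occur are within the confidence widths of the true means. -/
def IsClean {M d : ℕ} (T : ℕ) (L : ℝ) (nrm : Seminorm ℝ (JointArm M d))
    (ν : JointArm M d → Measure ℝ) (x : ℕ → ℝ) : Prop :=
  ∀ t < T, ∀ a, (traj T L nrm x t).pulls a ≠ 0 →
    |(traj T L nrm x t).empMean a - meanReward ν a| ≤ (traj T L nrm x t).width T a

namespace IsClean

variable {M d : ℕ} {T : ℕ} {L : ℝ} {nrm : Seminorm ℝ (JointArm M d)}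
  {ν : JointArm M d → Measure ℝ} {x : ℕ → ℝ}

/-- Let `y` be covered by the active arm `a`, and let `b` be the pulled arm. Then `μ_y ≤ μ_a + ε_a ≤
μ̂_a + 2 ε_a ≤ μ̂_b + 2 ε_b ≤ μ_b + 3 ε_b`; take the supremum over `y`. -/
theorem gap_le (h : IsClean T L nrm ν x) (hν : IsLipschitzBandit L nrm ν) (hL : 0 < L) {t : ℕ}
    (ht : t < T) (hp : (traj T L nrm x t).pulls (pulledArm T L nrm x t) ≠ 0) :
    gap ν (pulledArm T L nrm x t) ≤ 3 * (traj T L nrm x t).width T (pulledArm T L nrm x t) := by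
  set s := traj T L nrm x t with hs
  set b := pulledArm T L nrm x t with hb
  have hval : s.Valid := valid_traj T L nrm x t
  have hval' := hval.activate (T := T) (L := L) (nrm := nrm)
  have hcb := abs_le.1 (h t ht b hp)
  have key : ∀ y ∈ cube M d, meanReward ν y ≤ s.empMean b + 2 * s.width T b := by
    intro y hy
    obtain ⟨a, ha, hcov⟩ := hval.exists_covers (T := T) (nrm := nrm) hL hy
    have hle := (ZoomState.choice_spec (T := T) hval'.nonempty).2 a ha
    rw [ZoomState.ucb_activate, ZoomState.ucb_activate] at hle
    change s.ucb T a ≤ s.ucb T b at hle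
    rw [ZoomState.ucb, ZoomState.ucb, if_neg hp] at hle
    by_cases hpa : s.pulls a = 0
    -- An unpulled active arm would have infinite index and beat `b`, whose index is finite.
    · rw [if_pos hpa, top_le_iff] at hle
      exact absurd hle (EReal.coe_ne_top _)
    · rw [if_neg hpa, EReal.coe_le_coe_iff] at hle
      have hca := abs_le.1 (h t ht a hpa)
      have hd := hcov.resolve_left hpa
      rw [le_div_iff₀ hL, mul_comm] at hd
      have hlip := (abs_le.1 (hν.lipschitz y hy a (hval'.mem_cube a ha))).2
      linarith [hca.1]
  have : optMean ν ≤ s.empMean b + 2 * s.width T b := by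
    refine csSup_le ⟨_, b, pulledArm_mem_cube T L nrm x t, rfl⟩ ?_
    rintro _ ⟨y, hy, rfl⟩
    exact key y hy
  unfold gap
  linarith [hcb.2]

/-- When an arm with `n > 0` pulls is pulled again, `gap_le` gives `n Δ² ≤ 9 * 6 log T`. That pull
itself adds `Δ² ≤ 1 ≤ 2 log T`, whence 56 in place of 54. -/
theorem pulls_mul_sq_gap_le (h : IsClean T L nrm ν x) (hν : IsLipschitzBandit L nrm ν)
    (hL : 0 < L) (hT : 2 ≤ T) {a : JointArm M d} (ha : a ∈ cube M d) {t : ℕ} (ht : t ≤ T) :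
    (traj T L nrm x t).pulls a * gap ν a ^ 2 ≤ 56 * Real.log T := by
  classical
  have hlog := one_le_two_mul_log hT
  induction t with
  | zero => simp [traj_zero, ZoomState.init, ZoomState.pulls, ZoomState.rewards]; linarith
  | succ t ih =>
    rw [pulls_traj_succ]
    split_ifs with hb
    · have h0 := hν.gap_nonneg ha
      have h1 := hν.gap_le_one ha
      have hsq : gap ν a ^ 2 ≤ 1 := pow_le_one₀ h0 h1
      by_cases hp : (traj T L nrm x t).pulls a = 0
      · rw [hp]; push_cast; linarith
      · have hg := h.gap_le hν hL ht (by rwa [hb])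
        rw [hb] at hg
        have hpos : (0 : ℝ) < (traj T L nrm x t).pulls a := by
          exact_mod_cast Nat.pos_of_ne_zero hp
        have hw : (traj T L nrm x t).width T a ^ 2 =
            6 * Real.log T / (traj T L nrm x t).pulls a :=
          Real.sq_sqrt (div_nonneg (by linarith) hpos.le)
        have hg2 : gap ν a ^ 2 ≤ 9 * (6 * Real.log T / (traj T L nrm x t).pulls a) := by
          rw [← hw]
          calc gap ν a ^ 2 ≤ (3 * (traj T L nrm x t).width T a) ^ 2 := pow_le_pow_left₀ h0 hg 2
            _ = _ := by ring
        have : (traj T L nrm x t).pulls a * gap ν a ^ 2 ≤ 54 * Real.log T := by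
          calc _ ≤ (traj T L nrm x t).pulls a *
                (9 * (6 * Real.log T / (traj T L nrm x t).pulls a)) := by gcongr
            _ = _ := by field_simp; ring
        push_cast
        linarith
    · exact ih (Nat.le_of_succ_le ht)

/-- Active arms with large gaps are separated. -/
theorem lt_dist (h : IsClean T L nrm ν x) (hν : IsLipschitzBandit L nrm ν) (hL : 0 < L)
    (hT : 2 ≤ T) {r : ℝ} (hr : 0 < r) {t : ℕ} (ht : t ≤ T) {a b : JointArm M d}
    (ha : a ∈ (traj T L nrm x t).active) (hb : b ∈ (traj T L nrm x t).active) (hab : a ≠ b)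
    (hga : 3 / 2 * r ≤ gap ν a) (hgb : 3 / 2 * r ≤ gap ν b) : r / (3 * L) < nrm (a - b) := by
  classical
  have hlog := one_le_two_mul_log hT
  induction t with
  | zero =>
    simp only [traj_zero, ZoomState.init, Finset.mem_singleton] at ha hb
    exact absurd (ha.trans hb.symm) hab
  | succ t ih =>
    have ih := ih (Nat.le_of_succ_le ht)
    have hval := valid_traj T L nrm x t
    -- A newly activated arm lies outside the ball of each older arm `a`, so it suffices that the
    -- width of `a` is at least `r / 3`. A gap of only `r` would just miss this (56 / 9 > 6); the
    -- factor 3 / 2 gives the slack.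
    have key : ∀ a ∈ (traj T L nrm x t).active, ∀ b ∈ (traj T L nrm x t).uncovered T L nrm,
        3 / 2 * r ≤ gap ν a → r / (3 * L) < nrm (b - a) := by
      intro a ha b hb hga
      have hu := hb.2 a ha
      simp only [ZoomState.Covers, not_or, not_le] at hu
      refine lt_of_le_of_lt ?_ hu.2
      rw [← div_div]
      gcongr
      apply Real.le_sqrt_of_sq_le
      have hpos : (0 : ℝ) < (traj T L nrm x t).pulls a := by
        exact_mod_cast Nat.pos_of_ne_zero hu.1
      rw [le_div_iff₀ hpos]
      have hp := h.pulls_mul_sq_gap_le hν hL hT (hval.mem_cube a ha) (Nat.le_of_succ_le ht)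
      have : (traj T L nrm x t).pulls a * (3 / 2 * r) ^ 2 ≤ 56 * Real.log T :=
        le_trans (by gcongr) hp
      nlinarith
    rw [active_traj_succ] at ha hb
    rcases ZoomState.activate_cases T L nrm (traj T L nrm x t) with ⟨-, he⟩ | ⟨e, hu, he⟩
    · rw [he] at ha hb
      exact ih ha hb
    · rw [he, Finset.mem_insert] at ha hb
      rcases ha with rfl | ha <;> rcases hb with rfl | hb
      · exact absurd rfl hab
      · exact key b hb a hu hgb
      · rw [map_sub_rev]
        exact key a ha b hu hga
      · exact ih ha hb

theorem card_slice_le (h : IsClean T L nrm ν x) (hν : IsLipschitzBandit L nrm ν) (hL : 0 < L)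
    (hT : 2 ≤ T) {c : ℝ} (hc : IsZoomingMultiplier L nrm ν c) {r : ℝ} (hr : 0 < r)
    {S : Finset (JointArm M d)} (hS : S ⊆ (traj T L nrm x T).active)
    (hg : ∀ a ∈ S, 3 / 2 * r ≤ gap ν a ∧ gap ν a < 2 * r) :
    (S.card : ℝ) ≤ c / r ^ (M * d) := by
  obtain ⟨k, ⟨U, hdiam, hU⟩, hk⟩ := hc r hr
  refine le_trans ?_ hk
  have hmem : ∀ a ∈ S, ∃ i, a ∈ U i := fun a ha =>
    Set.mem_iUnion.1 (hU ⟨(valid_traj T L nrm x T).mem_cube a (hS ha),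
      by linarith [(hg a ha).1], (hg a ha).2⟩)
  rcases S.eq_empty_or_nonempty with rfl | ⟨e, he⟩
  · simp
  have : Nonempty (Fin k) := ⟨(hmem e he).choose⟩
  choose! f hf using hmem
  -- A covering set has diameter at most `r / (3 L)`, hence contains at most one of the separated
  -- arms.
  have hinj : Set.InjOn f S := by
    intro a ha b hb hab
    by_contra hne
    have h1 := h.lt_dist hν hL hT hr le_rfl (hS ha) (hS hb) hne (hg a ha).1 (hg b hb).1
    have h2 := hdiam (f a) a (hf a ha) b (hab ▸ hf b hb)
    linarith
  have := Finset.card_le_card_of_injOn (t := Finset.univ) f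
    (fun _ _ => Finset.mem_coe.2 (Finset.mem_univ _)) hinj
  rw [Finset.card_fin] at this
  exact_mod_cast this

theorem slice_regret_le (h : IsClean T L nrm ν x) (hν : IsLipschitzBandit L nrm ν) (hL : 0 < L)
    (hT : 2 ≤ T) {c : ℝ} (hc : IsZoomingMultiplier L nrm ν c) {r : ℝ} (hr : 0 < r)
    {S : Finset (JointArm M d)} (hS : S ⊆ (traj T L nrm x T).active)
    (hg : ∀ a ∈ S, 3 / 2 * r ≤ gap ν a ∧ gap ν a < 2 * r) :
    ∑ a ∈ S, (traj T L nrm x T).pulls a * gap ν a ≤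
      38 * (c * Real.log T) / r ^ (M * d + 1) := by
  have hlog := one_le_two_mul_log hT
  -- Dividing `56 log T` by the gap, which is at least `3 / 2 * r`, leaves a constant `112 / 3 ≤
  -- 38`.
  have hterm : ∀ a ∈ S, (traj T L nrm x T).pulls a * gap ν a ≤ 38 * Real.log T / r := by
    intro a ha
    have hp := h.pulls_mul_sq_gap_le hν hL hT ((valid_traj T L nrm x T).mem_cube a (hS ha)) le_rfl
    have hga := (hg a ha).1
    rw [le_div_iff₀ hr]
    have h0 : (0 : ℝ) ≤ (traj T L nrm x T).pulls a := Nat.cast_nonneg _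
    have : (traj T L nrm x T).pulls a * gap ν a * (3 / 2 * r) ≤
        (traj T L nrm x T).pulls a * gap ν a * gap ν a :=
      mul_le_mul_of_nonneg_left hga (mul_nonneg h0 (by linarith))
    nlinarith
  calc _ ≤ S.card • (38 * Real.log T / r) := Finset.sum_le_card_nsmul _ _ _ hterm
    _ ≤ c / r ^ (M * d) * (38 * Real.log T / r) := by
      rw [nsmul_eq_mul]
      have : 0 ≤ 38 * Real.log T / r := div_nonneg (by linarith) hr.le
      gcongr
      exact h.card_slice_le hν hL hT hc hr hS hg
    _ = _ := by rw [pow_succ]; field_simp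

/-- Rounds with gap below `3 / 2 * δ` cost at most that much each. The other rounds are grouped by
arm and then by gap scale; the slice bounds decrease geometrically, so the smallest scale `δ`
dominates. -/
theorem sum_gap_le (h : IsClean T L nrm ν x) (hν : IsLipschitzBandit L nrm ν) (hL : 0 < L)
    (hT : 2 ≤ T) {c : ℝ} (hc : IsZoomingMultiplier L nrm ν c) {δ : ℝ} (hδ : 0 < δ) :
    ∑ t ∈ Finset.range T, gap ν (pulledArm T L nrm x t) ≤
      3 / 2 * δ * T + 152 * (c * Real.log T) / δ ^ (M * d + 1) := by
  classical
  have hlog := one_le_two_mul_log hT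
  set A := (Finset.range T).image (pulledArm T L nrm x) with hA
  have hAact : A ⊆ (traj T L nrm x T).active := by
    intro a ha
    obtain ⟨t, ht, rfl⟩ := Finset.mem_image.1 ha
    have hmono : Monotone fun t => (traj T L nrm x t).active := by
      refine monotone_nat_of_le_succ fun t => ?_
      rw [active_traj_succ]
      rcases ZoomState.activate_cases T L nrm (traj T L nrm x t) with ⟨-, he⟩ | ⟨e, -, he⟩
      · rw [he]
      · rw [he]; exact Finset.subset_insert _ _
    exact hmono (Finset.mem_range.1 ht) (pulledArm_mem_active T L nrm x t)
  set B := A.filter fun a => 3 / 2 * δ ≤ gap ν a with hB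
  have hBcube : ∀ a ∈ B, a ∈ cube M d := fun a ha =>
    (valid_traj T L nrm x T).mem_cube a (hAact (Finset.mem_filter.1 ha).1)
  have hsplit : ∑ t ∈ Finset.range T, gap ν (pulledArm T L nrm x t) ≤
      3 / 2 * δ * T + ∑ a ∈ B, (traj T L nrm x T).pulls a * gap ν a := by
    have h1 : ∀ a, gap ν a ≤ 3 / 2 * δ + if 3 / 2 * δ ≤ gap ν a then gap ν a else 0 := by
      intro a
      split_ifs <;> linarith
    calc _ ≤ ∑ t ∈ Finset.range T, (3 / 2 * δ + if 3 / 2 * δ ≤ gap ν (pulledArm T L nrm x t) then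
            gap ν (pulledArm T L nrm x t) else 0) := Finset.sum_le_sum fun t _ => h1 _
      _ = 3 / 2 * δ * T + ∑ t ∈ Finset.range T,
            if 3 / 2 * δ ≤ gap ν (pulledArm T L nrm x t) then
            gap ν (pulledArm T L nrm x t) else 0 := by
          rw [Finset.sum_add_distrib]; simp [mul_comm]
      _ = _ := by
          congr 1
          rw [Finset.sum_comp (fun a => if 3 / 2 * δ ≤ gap ν a then gap ν a else 0)
            (pulledArm T L nrm x), hB, Finset.sum_filter]
          refine Finset.sum_congr rfl fun a _ => ?_
          rw [pulls_traj, Finset.sum_boole, nsmul_eq_mul, mul_ite, mul_zero]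
          simp
  -- The ratio 4 / 3 makes the intervals `[3/2 r, 2r)` adjacent, so that they partition the gaps
  -- from `3 / 2 * δ` on.
  set r : ℕ → ℝ := fun j => δ * (4 / 3) ^ j with hrdef
  have hrpos : ∀ j, 0 < r j := fun j => by positivity
  have hidx : ∀ a ∈ B, ∃ j, 3 / 2 * r j ≤ gap ν a ∧ gap ν a < 2 * r j := by
    intro a ha
    have hge := (Finset.mem_filter.1 ha).2
    obtain ⟨j, h1, h2⟩ := exists_nat_pow_near (x := gap ν a / (3 / 2 * δ)) (y := (4 / 3 : ℝ))
      ((one_le_div (by positivity)).2 hge) (by norm_num)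
    refine ⟨j, ?_, ?_⟩
    · rw [le_div_iff₀ (by positivity)] at h1
      simp only [hrdef]; linarith
    · rw [div_lt_iff₀ (by positivity), pow_succ] at h2
      simp only [hrdef]; linarith
  choose! f hf using hidx
  have hslices : ∑ a ∈ B, (traj T L nrm x T).pulls a * gap ν a =
      ∑ j ∈ B.image f, ∑ a ∈ B with f a = j, (traj T L nrm x T).pulls a * gap ν a :=
    (Finset.sum_fiberwise_of_maps_to (fun a ha => Finset.mem_image_of_mem f ha) _).symm
  have hq : ∀ j : ℕ, 38 * (c * Real.log T) / r j ^ (M * d + 1) ≤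
      38 * (c * Real.log T) / δ ^ (M * d + 1) * (3 / 4) ^ j := by
    intro j
    have hcl : 0 ≤ c * Real.log T := mul_nonneg hc.nonneg (by linarith)
    have : δ ^ (M * d + 1) * (4 / 3) ^ j ≤ r j ^ (M * d + 1) := by
      rw [hrdef, mul_pow]
      gcongr
      exact le_self_pow₀ (one_le_pow₀ (by norm_num)) (by omega)
    calc _ ≤ 38 * (c * Real.log T) / (δ ^ (M * d + 1) * (4 / 3) ^ j) := by gcongr
      _ = _ := by
        rw [show (3 / 4 : ℝ) = (4 / 3)⁻¹ by norm_num, inv_pow, div_mul_eq_div_div, div_eq_mul_inv]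
  have hgeom : ∑ j ∈ B.image f, (3 / 4 : ℝ) ^ j ≤ 4 := by
    have hs := summable_geometric_of_lt_one (r := (3 / 4 : ℝ)) (by norm_num) (by norm_num)
    refine (hs.sum_le_tsum _ fun j _ => by positivity).trans ?_
    rw [tsum_geometric_of_lt_one (by norm_num) (by norm_num)]
    norm_num
  have hcl : 0 ≤ 38 * (c * Real.log T) / δ ^ (M * d + 1) :=
    div_nonneg (mul_nonneg (by norm_num) (mul_nonneg hc.nonneg (by linarith))) (by positivity)
  refine hsplit.trans (add_le_add le_rfl ?_)
  rw [hslices]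
  calc _ ≤ ∑ j ∈ B.image f, 38 * (c * Real.log T) / δ ^ (M * d + 1) * (3 / 4) ^ j := by
        refine Finset.sum_le_sum fun j _ => le_trans ?_ (hq j)
        refine h.slice_regret_le hν hL hT hc (hrpos j) ?_ ?_
        · exact (Finset.filter_subset _ _).trans ((Finset.filter_subset _ _).trans hAact)
        · intro a ha
          obtain ⟨haB, rfl⟩ := Finset.mem_filter.1 ha
          exact hf a haB
    _ ≤ 38 * (c * Real.log T) / δ ^ (M * d + 1) * 4 := by
        rw [← Finset.mul_sum]
        gcongr
    _ = _ := by ring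

end IsClean

/-! ### Measurability of the pulled arms -/

/-- A function with finitely many values and measurable fibres. -/
def IsSimple {α β : Type*} [MeasurableSpace α] (f : α → β) : Prop :=
  ∃ g : SimpleFunc α β, ⇑g = f

namespace IsSimple

variable {α β γ : Type*} [MeasurableSpace α]

theorem const (b : β) : IsSimple fun _ : α => b := ⟨SimpleFunc.const α b, rfl⟩

theorem map {f : α → β} (hf : IsSimple f) (g : β → γ) : IsSimple fun x => g (f x) := by
  obtain ⟨f, rfl⟩ := hf
  exact ⟨f.map g, rfl⟩

theorem pair {f : α → β} {g : α → γ} (hf : IsSimple f) (hg : IsSimple g) :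
    IsSimple fun x => (f x, g x) := by
  obtain ⟨f, rfl⟩ := hf
  obtain ⟨g, rfl⟩ := hg
  exact ⟨f.pair g, rfl⟩

theorem bind {f : α → β} (hf : IsSimple f) {g : β → α → γ} (hg : ∀ b, IsSimple (g b)) :
    IsSimple fun x => g (f x) x := by
  obtain ⟨f, rfl⟩ := hf
  choose g' hg' using hg
  refine ⟨f.bind g', ?_⟩
  funext x
  rw [SimpleFunc.bind_apply, hg']

theorem measurable [MeasurableSpace β] {f : α → β} (hf : IsSimple f) : Measurable f := by
  obtain ⟨f, rfl⟩ := hf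
  exact f.measurable

theorem measurableSet {f : α → β} (hf : IsSimple f) (p : β → Prop) :
    MeasurableSet {x | p (f x)} := by
  obtain ⟨f, rfl⟩ := hf
  exact f.measurableSet_preimage {b | p b}

/-- Filtering a fixed finite set by measurable conditions. -/
theorem filter (A : Finset β) {p : α → β → Prop} [∀ x, DecidablePred (p x)]
    (hp : ∀ a ∈ A, MeasurableSet {x | p x a}) : IsSimple fun x => A.filter (p x) := by
  classical
  refine ⟨⟨fun x => A.filter (p x), fun S => ?_, ?_⟩, rfl⟩
  · have : (fun x => A.filter (p x)) ⁻¹' {S} =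
        {x | ∀ a ∈ A, (p x a ↔ a ∈ S)} ∩ {_x | S ⊆ A} := by
      ext x
      simp only [Set.mem_preimage, Set.mem_singleton_iff, Set.mem_inter_iff, Set.mem_ofPred_eq]
      constructor
      · rintro rfl
        exact ⟨fun a ha => by simp [ha], Finset.filter_subset _ _⟩
      · rintro ⟨h1, h2⟩
        ext a
        rw [Finset.mem_filter]
        exact ⟨fun h => (h1 a h.1).1 h.2, fun h => ⟨h2 h, (h1 a (h2 h)).2 h⟩⟩
    rw [this]
    refine MeasurableSet.inter ?_ (MeasurableSet.const _)
    have h2 : {x | ∀ a ∈ A, (p x a ↔ a ∈ S)} = ⋂ a ∈ A, {x | p x a ↔ a ∈ S} := by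
      ext x; simp
    rw [h2]
    refine Finset.measurableSet_biInter _ fun a ha => ?_
    by_cases hS : a ∈ S
    · simpa [hS] using hp a ha
    · have h3 : {x | p x a ↔ a ∈ S} = {x | p x a}ᶜ := by ext x; simp [hS]
      rw [h3]
      exact (hp a ha).compl
  · refine (A.powerset.finite_toSet).subset ?_
    rintro _ ⟨x, rfl⟩
    exact Finset.mem_coe.2 (Finset.mem_powerset.2 (Finset.filter_subset _ _))

end IsSimple

namespace ZoomState

variable {M d : ℕ} {T : ℕ} {L : ℝ} {nrm : Seminorm ℝ (JointArm M d)}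

/-- The memory with all recorded rewards replaced by zero. -/
def skeleton (s : ZoomState M d) : ZoomState M d :=
  { s with record := s.record.map fun p => (p.1, 0) }

theorem pulls_skeleton (s : ZoomState M d) (a : JointArm M d) :
    s.skeleton.pulls a = s.pulls a := by
  classical
  simp [skeleton, pulls, rewards, List.filter_map, Function.comp_def]

theorem covers_skeleton (s : ZoomState M d) (a x : JointArm M d) :
    s.skeleton.Covers T L nrm a x ↔ s.Covers T L nrm a x := by
  simp only [Covers, width, pulls_skeleton]

theorem uncovered_skeleton (s : ZoomState M d) :
    s.skeleton.uncovered T L nrm = s.uncovered T L nrm := by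
  simp only [uncovered, covers_skeleton]
  rfl

/-- Activation looks at the pull counts only, never at the reward values. Reward values can thus
influence the active set only through the arms chosen. -/
theorem activate_skeleton (s : ZoomState M d) :
    s.skeleton.activate T L nrm = (s.activate T L nrm).skeleton := by
  simp only [activate]
  rw [uncovered_skeleton]
  split_ifs <;> rfl

end ZoomState

section Trajectory

variable {M d : ℕ} (T : ℕ) (L : ℝ) (nrm : Seminorm ℝ (JointArm M d))

theorem measurable_ucb_traj {t : ℕ}
    (hs : ∀ s < t, IsSimple fun x : ℕ → ℝ => pulledArm T L nrm x s) (a : JointArm M d) :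
    Measurable fun x : ℕ → ℝ => (traj T L nrm x t).ucb T a := by
  classical
  have hp : Measurable fun x : ℕ → ℝ => (traj T L nrm x t).pulls a := by
    simp only [pulls_traj]
    refine Finset.measurable_sum _ fun s hst => ?_
    exact Measurable.ite ((hs s (Finset.mem_range.1 hst)).measurableSet (· = a))
      measurable_const measurable_const
  have hr : Measurable fun x : ℕ → ℝ => ((traj T L nrm x t).rewards a).sum := by
    simp only [rewards_sum_traj]
    refine Finset.measurable_sum _ fun s hst => ?_
    exact Measurable.ite ((hs s (Finset.mem_range.1 hst)).measurableSet (· = a))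
      (measurable_pi_apply s) measurable_const
  have hp' : Measurable fun x : ℕ → ℝ => ((traj T L nrm x t).pulls a : ℝ) :=
    measurable_from_nat.comp hp
  unfold ZoomState.ucb ZoomState.empMean ZoomState.width
  refine Measurable.ite (hp (measurableSet_singleton 0)) measurable_const ?_
  exact ((hr.div hp').add ((hp'.const_div _).sqrt.const_mul 2)).coe_real_ereal

/-- The memory without reward values takes finitely many values in each round: given the active set,
the reward values matter only through finitely many measurable comparisons of indices. The induction
carries the skeleton together with the earlier arms. Simplicity makes every function of the arm
measurable, including `ν` itself. -/
theorem isSimple_pulledArm (t : ℕ) : IsSimple fun x : ℕ → ℝ => pulledArm T L nrm x t := by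
  classical
  suffices h : ∀ t, (∀ s < t, IsSimple fun x : ℕ → ℝ => pulledArm T L nrm x s) ∧
      IsSimple fun x : ℕ → ℝ => (traj T L nrm x t).skeleton from
    (h (t + 1)).1 t (Nat.lt_succ_self t)
  intro t
  induction t with
  | zero => exact ⟨fun s hs => absurd hs (Nat.not_lt_zero s),
      IsSimple.const (ZoomState.init M d).skeleton⟩
  | succ t ih =>
    obtain ⟨ih1, ih2⟩ := ih
    have hact := ih2.map fun s => s.activate T L nrm
    have harm : IsSimple fun x : ℕ → ℝ => pulledArm T L nrm x t := by
      have hb := (hact.bind (g := fun s x => s.active.filter fun a => ∀ b ∈ s.active,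
        (traj T L nrm x t).ucb T b ≤ (traj T L nrm x t).ucb T a) fun s => by
          refine IsSimple.filter _ fun a _ => ?_
          have : {x : ℕ → ℝ | ∀ b ∈ s.active,
              (traj T L nrm x t).ucb T b ≤ (traj T L nrm x t).ucb T a} =
              ⋂ b ∈ s.active, {x | (traj T L nrm x t).ucb T b ≤ (traj T L nrm x t).ucb T a} := by
            ext x; simp
          rw [this]
          exact Finset.measurableSet_biInter _ fun b _ => measurableSet_le
            (measurable_ucb_traj T L nrm ih1 b) (measurable_ucb_traj T L nrm ih1 a)).map leastArm
      convert hb using 2 with x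
      have hs : ((traj T L nrm x t).skeleton.activate T L nrm).active =
          ((traj T L nrm x t).activate T L nrm).active := by
        rw [ZoomState.activate_skeleton]; rfl
      rw [pulledArm, ZoomState.choice, hs]
      simp only [ZoomState.ucb_activate]
    refine ⟨fun s hs => ?_, ?_⟩
    · rcases Nat.lt_succ_iff_lt_or_eq.1 hs with h | rfl
      exacts [ih1 s h, harm]
    · have := (hact.pair harm).map fun p : ZoomState M d × JointArm M d =>
        { p.1 with record := (p.2, 0) :: p.1.record }
      convert this using 2 with x
      rw [traj_succ, ZoomState.activate_skeleton]
      rfl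

theorem measurable_pulls_pulledArm (t : ℕ) :
    Measurable fun x : ℕ → ℝ => (traj T L nrm x t).pulls (pulledArm T L nrm x t) := by
  classical
  simp only [pulls_traj]
  refine Finset.measurable_sum _ fun s _ => ?_
  exact Measurable.ite (((isSimple_pulledArm T L nrm s).pair
    (isSimple_pulledArm T L nrm t)).measurableSet fun p => p.1 = p.2)
      measurable_const measurable_const

end Trajectory

/-! ### The law of the rewards -/

/-- The sequence that continues a finite sequence by zeros. -/
def extendByZero (t : ℕ) (y : Fin t → ℝ) : ℕ → ℝ := fun s => if h : s < t then y ⟨s, h⟩ else 0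

theorem measurable_extendByZero (t : ℕ) : Measurable (extendByZero t) := by
  refine measurable_pi_lambda _ fun s => ?_
  unfold extendByZero
  split_ifs with h
  exacts [measurable_pi_apply _, measurable_const]

theorem extendByZero_apply {t s : ℕ} (h : s < t) (x : ℕ → ℝ) :
    extendByZero t (fun s : Fin t => x s) s = x s := by
  simp [extendByZero, h]

section Law

variable {M d : ℕ} {T : ℕ} {L : ℝ} {nrm : Seminorm ℝ (JointArm M d)}
  {ν : JointArm M d → Measure ℝ}

/-- The conditional distribution of the reward of round `t` given the past rewards. -/
def rewardKernel (T : ℕ) (L : ℝ) (nrm : Seminorm ℝ (JointArm M d))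
    (ν : JointArm M d → Measure ℝ) (t : ℕ) : Kernel (Fin t → ℝ) ℝ where
  toFun y := ν (pulledArm T L nrm (extendByZero t y) t)
  measurable' := ((isSimple_pulledArm T L nrm t).map ν).measurable.comp (measurable_extendByZero t)

theorem rewardKernel_apply (t : ℕ) (y : Fin t → ℝ) :
    rewardKernel T L nrm ν t y = ν (pulledArm T L nrm (extendByZero t y) t) := rfl

theorem rewardKernel_apply_restrict (t : ℕ) (x : ℕ → ℝ) :
    rewardKernel T L nrm ν t (fun s : Fin t => x s) = ν (pulledArm T L nrm x t) := by
  rw [rewardKernel_apply, pulledArm_congr T L nrm fun s hs => extendByZero_apply hs x]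

theorem IsLipschitzBandit.isMarkovKernel (hν : IsLipschitzBandit L nrm ν) (t : ℕ) :
    IsMarkovKernel (rewardKernel T L nrm ν t) :=
  ⟨fun _ => hν.prob _ (pulledArm_mem_cube _ _ _ _ _)⟩

theorem IsLipschitzBandit.integrable_id (hν : IsLipschitzBandit L nrm ν) {a : JointArm M d}
    (ha : a ∈ cube M d) : Integrable (fun y => y) (ν a) := by
  have := hν.prob a ha
  have h := (hν.subgaussian a ha).integrable.add (integrable_const (meanReward ν a))
  exact h.congr (Filter.Eventually.of_forall fun y => sub_add_cancel _ _)

/-- The moment generating function of the deviation of the reward from its mean. -/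
theorem IsLipschitzBandit.lintegral_exp_le (hν : IsLipschitzBandit L nrm ν) {a : JointArm M d}
    (ha : a ∈ cube M d) (l : ℝ) :
    ∫⁻ y, ENNReal.ofReal (Real.exp (l * (y - meanReward ν a) - l ^ 2 / 2)) ∂(ν a) ≤ 1 := by
  have hs := hν.subgaussian a ha
  have hi := (hs.integrable_exp_mul l).mul_const (Real.exp (-(l ^ 2 / 2)))
  simp only [← Real.exp_add, ← sub_eq_add_neg] at hi
  rw [← ofReal_integral_eq_lintegral_ofReal hi
    (Filter.Eventually.of_forall fun y => (Real.exp_pos _).le), ENNReal.ofReal_le_one]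
  simp only [sub_eq_add_neg _ (l ^ 2 / 2), Real.exp_add]
  rw [integral_mul_const]
  calc _ ≤ Real.exp ((1 : NNReal) * l ^ 2 / 2) * Real.exp (-(l ^ 2 / 2)) :=
        mul_le_mul_of_nonneg_right (hs.mgf_le l) (Real.exp_pos _).le
    _ = 1 := by rw [← Real.exp_add]; simp

variable {Ω : Type*} [MeasurableSpace Ω] {P : Measure Ω} {X : ℕ → Ω → ℝ}

namespace IsRewardProcess

theorem measurable_past (hX : IsRewardProcess P T L nrm ν X) {t : ℕ} (ht : t ≤ T) :
    Measurable fun ω => fun s : Fin t => X s ω :=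
  measurable_pi_lambda _ fun s => hX.measurable s (s.2.trans_le ht)

/-- Functions of the first `t` rewards are measurable. -/
theorem measurable_comp (hX : IsRewardProcess P T L nrm ν X) {t : ℕ} (ht : t ≤ T)
    {β : Type*} [MeasurableSpace β] {f : (ℕ → ℝ) → β} (hf : Measurable f)
    (hcongr : ∀ x y : ℕ → ℝ, (∀ s < t, x s = y s) → f x = f y) :
    Measurable fun ω => f fun s => X s ω := by
  -- Nothing is known about the rewards after the horizon, so `f` is evaluated on the sequence
  -- truncated at `t`.
  have := (hf.comp (measurable_extendByZero t)).comp (hX.measurable_past ht)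
  convert this using 2 with ω
  exact hcongr _ _ fun s hs => (extendByZero_apply hs fun s => X s ω).symm

theorem measurable_pulledArm (hX : IsRewardProcess P T L nrm ν X) {t : ℕ} (ht : t ≤ T)
    (g : JointArm M d → ℝ) :
    Measurable fun ω => g (pulledArm T L nrm (fun s => X s ω) t) :=
  hX.measurable_comp ht ((isSimple_pulledArm T L nrm t).map g).measurable
    fun x y h => by rw [pulledArm_congr T L nrm h]

variable [IsProbabilityMeasure P]

/-- `cond_law` prescribes the joint law on rectangles, and these determine it. -/
theorem map_eq_compProd (hX : IsRewardProcess P T L nrm ν X) (hν : IsLipschitzBandit L nrm ν)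
    {t : ℕ} (ht : t < T) :
    P.map (fun ω => ((fun s : Fin t => X s ω), X t ω)) =
      P.map (fun ω => fun s : Fin t => X s ω) ⊗ₘ rewardKernel T L nrm ν t := by
  have := hν.isMarkovKernel (T := T) t
  have hp := hX.measurable_past ht.le
  have hpx := hp.prodMk (hX.measurable t ht)
  have := Measure.isProbabilityMeasure_map (μ := P) hpx.aemeasurable
  refine Measure.ext_prod fun {C B} hC hB => ?_
  rw [Measure.map_apply hpx (hC.prod hB), Measure.compProd_apply_prod hC hB,
    setLIntegral_map hC (Kernel.measurable_coe _ hB) hp]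
  refine (hX.cond_law t ht C B hC hB).trans ?_
  refine lintegral_congr fun ω => ?_
  rw [armAt_eq_pulledArm]
  exact congrArg (fun m : Measure ℝ => m B)
    (rewardKernel_apply_restrict t fun s => X s ω).symm

theorem lintegral_eq (hX : IsRewardProcess P T L nrm ν X) (hν : IsLipschitzBandit L nrm ν)
    {t : ℕ} (ht : t < T) {f : (Fin t → ℝ) × ℝ → ENNReal} (hf : Measurable f) :
    ∫⁻ ω, f ((fun s : Fin t => X s ω), X t ω) ∂P =
      ∫⁻ ω, ∫⁻ y, f ((fun s : Fin t => X s ω), y) ∂(ν (armAt T L nrm X t ω)) ∂P := by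
  have := hν.isMarkovKernel (T := T) t
  have hp := hX.measurable_past ht.le
  have hpx := hp.prodMk (hX.measurable t ht)
  have := Measure.isProbabilityMeasure_map (μ := P) hp.aemeasurable
  rw [← lintegral_map hf hpx, hX.map_eq_compProd hν ht, Measure.lintegral_compProd hf,
    lintegral_map (hf.lintegral_kernel_prod_right') hp]
  refine lintegral_congr fun ω => ?_
  rw [armAt_eq_pulledArm]
  exact congrArg (fun m : Measure ℝ => ∫⁻ y, f ((fun s : Fin t => X s ω), y) ∂m)
    (rewardKernel_apply_restrict t fun s => X s ω)

theorem integrable_snd (hX : IsRewardProcess P T L nrm ν X) (hν : IsLipschitzBandit L nrm ν)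
    {t : ℕ} (ht : t < T) :
    Integrable Prod.snd (P.map (fun ω => fun s : Fin t => X s ω) ⊗ₘ rewardKernel T L nrm ν t) := by
  have := hν.isMarkovKernel (T := T) t
  have hp := hX.measurable_past ht.le
  have := Measure.isProbabilityMeasure_map (μ := P) hp.aemeasurable
  rw [Measure.integrable_compProd_iff measurable_snd.aestronglyMeasurable]
  refine ⟨Filter.Eventually.of_forall fun y => hν.integrable_id (pulledArm_mem_cube _ _ _ _ _), ?_⟩
  -- The conditional first absolute moment is a simple function of the past, hence integrable.
  obtain ⟨g, hg⟩ := (isSimple_pulledArm T L nrm t).map fun a => ∫ y, ‖y‖ ∂(ν a)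
  have hgi := (g.comp _ (measurable_extendByZero t)).integrable_of_isFiniteMeasure
    (μ := P.map fun ω => fun s : Fin t => X s ω)
  refine hgi.congr (Filter.Eventually.of_forall fun y => ?_)
  exact congrFun hg (extendByZero t y)

theorem integrable (hX : IsRewardProcess P T L nrm ν X) (hν : IsLipschitzBandit L nrm ν)
    {t : ℕ} (ht : t < T) : Integrable (X t) P := by
  have hpx := (hX.measurable_past ht.le).prodMk (hX.measurable t ht)
  have h := hX.integrable_snd hν ht
  rw [← hX.map_eq_compProd hν ht] at h
  exact h.comp_measurable hpx

theorem integral_eq (hX : IsRewardProcess P T L nrm ν X) (hν : IsLipschitzBandit L nrm ν)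
    {t : ℕ} (ht : t < T) :
    ∫ ω, X t ω ∂P = ∫ ω, meanReward ν (armAt T L nrm X t ω) ∂P := by
  have := hν.isMarkovKernel (T := T) t
  have hp := hX.measurable_past ht.le
  have hpx := hp.prodMk (hX.measurable t ht)
  have := Measure.isProbabilityMeasure_map (μ := P) hp.aemeasurable
  have h1 := integral_map (μ := P) hpx.aemeasurable
    (f := Prod.snd) measurable_snd.aestronglyMeasurable
  rw [← h1, hX.map_eq_compProd hν ht, Measure.integral_compProd (hX.integrable_snd hν ht)]
  have hm : Measurable fun y : Fin t → ℝ =>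
      meanReward ν (pulledArm T L nrm (extendByZero t y) t) :=
    ((isSimple_pulledArm T L nrm t).map (meanReward ν)).measurable.comp (measurable_extendByZero t)
  refine (integral_map hp.aemeasurable hm.aestronglyMeasurable).trans ?_
  refine integral_congr_ae (Filter.Eventually.of_forall fun ω => ?_)
  simp only [armAt_eq_pulledArm]
  rw [pulledArm_congr T L nrm fun s hs => extendByZero_apply hs fun s => X s ω]

end IsRewardProcess

variable [IsProbabilityMeasure P]

/-- The exponent of the supermartingale for the weights `l`. -/
def weightedSum (T : ℕ) (L : ℝ) (nrm : Seminorm ℝ (JointArm M d))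
    (ν : JointArm M d → Measure ℝ) (l : ℕ → (ℕ → ℝ) → ℝ) (t : ℕ) (x : ℕ → ℝ) : ℝ :=
  ∑ s ∈ Finset.range t, (l s x * (x s - meanReward ν (pulledArm T L nrm x s)) - l s x ^ 2 / 2)

theorem measurable_weightedSum {l : ℕ → (ℕ → ℝ) → ℝ} (hl : ∀ s, Measurable (l s)) (t : ℕ) :
    Measurable (weightedSum T L nrm ν l t) := by
  refine Finset.measurable_sum _ fun s _ => ?_
  exact ((hl s).mul ((measurable_pi_apply s).sub
    ((isSimple_pulledArm T L nrm s).map (meanReward ν)).measurable)).sub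
    (((hl s).pow_const 2).div_const 2)

theorem weightedSum_congr {l : ℕ → (ℕ → ℝ) → ℝ}
    (hl : ∀ s, ∀ x y : ℕ → ℝ, (∀ j < s, x j = y j) → l s x = l s y) {t : ℕ} {x y : ℕ → ℝ}
    (h : ∀ s < t, x s = y s) : weightedSum T L nrm ν l t x = weightedSum T L nrm ν l t y := by
  refine Finset.sum_congr rfl fun s hs => ?_
  have hs := Finset.mem_range.1 hs
  have h' : ∀ j < s, x j = y j := fun j hj => h j (hj.trans hs)
  rw [hl s x y h', h s hs, pulledArm_congr T L nrm h']

/-- Condition on the first `t` rewards: the weight and the arm of round `t` are then fixed, and the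
last factor has mean at most 1 by subgaussianity. Working with `∫⁻` avoids any integrability
question for the random weights. -/
theorem IsRewardProcess.lintegral_exp_weightedSum_le (hX : IsRewardProcess P T L nrm ν X)
    (hν : IsLipschitzBandit L nrm ν) {l : ℕ → (ℕ → ℝ) → ℝ} (hlm : ∀ s, Measurable (l s))
    (hl : ∀ s, ∀ x y : ℕ → ℝ, (∀ j < s, x j = y j) → l s x = l s y) {t : ℕ} (ht : t ≤ T) :
    ∫⁻ ω, ENNReal.ofReal (Real.exp (weightedSum T L nrm ν l t fun s => X s ω)) ∂P ≤ 1 := by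
  induction t with
  | zero => simp [weightedSum]
  | succ t ih =>
    refine le_trans ?_ (ih (Nat.le_of_succ_le ht))
    set f : (Fin t → ℝ) × ℝ → ENNReal := fun p =>
      ENNReal.ofReal (Real.exp (weightedSum T L nrm ν l t (extendByZero t p.1))) *
        ENNReal.ofReal (Real.exp (l t (extendByZero t p.1) *
          (p.2 - meanReward ν (pulledArm T L nrm (extendByZero t p.1) t)) -
            l t (extendByZero t p.1) ^ 2 / 2)) with hf
    have hext : Measurable fun p : (Fin t → ℝ) × ℝ => extendByZero t p.1 :=
      (measurable_extendByZero t).comp measurable_fst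
    have hlt := (hlm t).comp hext
    have hfm : Measurable f := by
      refine ((measurable_weightedSum hlm t).comp hext).exp.ennreal_ofReal.mul ?_
      exact ((hlt.mul (measurable_snd.sub
        (((isSimple_pulledArm T L nrm t).map (meanReward ν)).measurable.comp hext))).sub
        ((hlt.pow_const 2).div_const 2)).exp.ennreal_ofReal
    have hpast : ∀ ω y, f ((fun s : Fin t => X s ω), y) =
        ENNReal.ofReal (Real.exp (weightedSum T L nrm ν l t fun s => X s ω)) *
        ENNReal.ofReal (Real.exp (l t (fun s => X s ω) *
          (y - meanReward ν (pulledArm T L nrm (fun s => X s ω) t)) -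
            l t (fun s => X s ω) ^ 2 / 2)) := by
      intro ω y
      have he : ∀ s < t, extendByZero t (fun s : Fin t => X s ω) s = X s ω := fun s hs =>
        extendByZero_apply hs fun s => X s ω
      simp only [hf]
      rw [weightedSum_congr hl he, hl t _ _ he, pulledArm_congr T L nrm he]
    calc _ = ∫⁻ ω, f ((fun s : Fin t => X s ω), X t ω) ∂P := by
          refine lintegral_congr fun ω => ?_
          rw [hpast, ← ENNReal.ofReal_mul (Real.exp_pos _).le, ← Real.exp_add, weightedSum,
            Finset.sum_range_succ]
          rfl
      _ = _ := hX.lintegral_eq hν ht hfm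
      _ ≤ _ := by
          refine lintegral_mono fun ω => ?_
          simp only [hpast, armAt_eq_pulledArm]
          rw [lintegral_const_mul' _ _ ENNReal.ofReal_ne_top]
          have h := hν.lintegral_exp_le (pulledArm_mem_cube T L nrm (fun s => X s ω) t)
            (l t fun s => X s ω)
          exact mul_le_of_le_one_right zero_le h

end Law

/-! ### The clean event -/

section Clean

variable {M d : ℕ} {T : ℕ} {L : ℝ} {nrm : Seminorm ℝ (JointArm M d)}
  {ν : JointArm M d → Measure ℝ}

open Classical in
/-- The weight `l` on the first `n` pulls of the arm of round `k`. -/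
def firstPullsWeight (T : ℕ) (L : ℝ) (nrm : Seminorm ℝ (JointArm M d)) (k n : ℕ) (l : ℝ) (s : ℕ)
    (x : ℕ → ℝ) : ℝ :=
  if k ≤ s ∧ pulledArm T L nrm x s = pulledArm T L nrm x k ∧
    (traj T L nrm x s).pulls (pulledArm T L nrm x s) < n then l else 0

theorem measurable_firstPullsWeight (k n : ℕ) (l : ℝ) (s : ℕ) :
    Measurable (firstPullsWeight T L nrm k n l s) := by
  classical
  unfold firstPullsWeight
  refine Measurable.ite ?_ measurable_const measurable_const
  exact (MeasurableSet.const _).inter ((((isSimple_pulledArm T L nrm s).pair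
    (isSimple_pulledArm T L nrm k)).measurableSet fun p => p.1 = p.2).inter
    (measurable_pulls_pulledArm T L nrm s measurableSet_Iio))

/-- Predictability of the weights. The condition `k ≤ s` is what ensures it: the arm of round `k` is
not determined by the rewards before an earlier round `s`. -/
theorem firstPullsWeight_congr (k n : ℕ) (l : ℝ) (s : ℕ) (x y : ℕ → ℝ)
    (h : ∀ j < s, x j = y j) :
    firstPullsWeight T L nrm k n l s x = firstPullsWeight T L nrm k n l s y := by
  classical
  by_cases hk : k ≤ s
  · rw [firstPullsWeight, firstPullsWeight, traj_congr T L nrm h, pulledArm_congr T L nrm h,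
      pulledArm_congr T L nrm fun j hj => h j (hj.trans_le hk)]
  · simp [firstPullsWeight, hk]

/-- The weighted sum for the first `n` pulls of an arm which has been pulled `n` times before
round `t`. -/
theorem exists_weightedSum_eq {x : ℕ → ℝ} {t : ℕ} (ht : t < T) {a : JointArm M d}
    (hp : (traj T L nrm x t).pulls a ≠ 0) :
    ∃ k < T, ∀ l : ℝ,
      weightedSum T L nrm ν (firstPullsWeight T L nrm k ((traj T L nrm x t).pulls a) l) T x =
        (traj T L nrm x t).pulls a *
          (l * ((traj T L nrm x t).empMean a - meanReward ν a) - l ^ 2 / 2) := by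
  classical
  set n := (traj T L nrm x t).pulls a with hn
  have hex : ∃ k, k < t ∧ pulledArm T L nrm x k = a := by
    by_contra! hno
    apply hp
    rw [hn, pulls_traj]
    exact Finset.sum_eq_zero fun s hs => if_neg (hno s (Finset.mem_range.1 hs))
  -- `k` must be the first pull of `a`, so that the condition `k ≤ s` discards none of its pulls.
  obtain ⟨hkt, hka⟩ := Nat.find_spec hex
  have hmin : ∀ s < t, pulledArm T L nrm x s = a → Nat.find hex ≤ s := fun s hs hsa =>
    Nat.find_min' hex ⟨hs, hsa⟩
  generalize Nat.find hex = k at hkt hka hmin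
  refine ⟨k, hkt.trans ht, fun l => ?_⟩
  -- The count stays at least `n` from round `t` on, so stopping after `n` pulls selects exactly the
  -- pulls before `t` although `t` does not occur in the weight.
  have hcond : ∀ s, (k ≤ s ∧ pulledArm T L nrm x s = pulledArm T L nrm x k ∧
      (traj T L nrm x s).pulls (pulledArm T L nrm x s) < n) ↔
      (s < t ∧ pulledArm T L nrm x s = a) := by
    intro s
    rw [hka]
    constructor
    · rintro ⟨-, hsa, hlt⟩
      refine ⟨?_, hsa⟩
      by_contra! hts
      rw [hsa] at hlt
      exact absurd (pulls_traj_mono T L nrm x a hts) (not_le.2 hlt)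
    · rintro ⟨hst, hsa⟩
      refine ⟨hmin s hst hsa, hsa, ?_⟩
      have h1 := pulls_traj_mono T L nrm x a (Nat.succ_le_of_lt hst)
      simp only [Nat.succ_eq_add_one] at h1
      rw [pulls_traj_succ, if_pos hsa] at h1
      rw [hsa]
      omega
  set F := (Finset.range t).filter fun s => pulledArm T L nrm x s = a with hF
  have hcard : (n : ℝ) = F.card := by
    rw [hn, pulls_traj, Finset.sum_boole]; rfl
  have hsum : ((traj T L nrm x t).rewards a).sum = ∑ s ∈ F, x s := by
    rw [rewards_sum_traj, hF, Finset.sum_filter]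
  have hn0 : (F.card : ℝ) ≠ 0 := by rw [← hcard]; exact_mod_cast hp
  have hFT : F = (Finset.range T).filter fun s => s < t ∧ pulledArm T L nrm x s = a := by
    ext s
    simp only [hF, Finset.mem_filter, Finset.mem_range]
    constructor
    · rintro ⟨h1, h2⟩; exact ⟨h1.trans ht, h1, h2⟩
    · rintro ⟨-, h1, h2⟩; exact ⟨h1, h2⟩
  have hw : weightedSum T L nrm ν (firstPullsWeight T L nrm k n l) T x =
      ∑ s ∈ F, (l * (x s - meanReward ν a) - l ^ 2 / 2) := by
    rw [hFT, Finset.sum_filter, weightedSum]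
    refine Finset.sum_congr rfl fun s _ => ?_
    simp only [firstPullsWeight, hcond]
    split_ifs with h
    · rw [h.2]
    · simp
  rw [hw, ZoomState.empMean, ← hn, hcard, hsum, Finset.sum_sub_distrib, ← Finset.mul_sum,
    Finset.sum_sub_distrib]
  simp only [Finset.sum_const, nsmul_eq_mul]
  field_simp

/-- With weight of size `w = ε_a` and the sign of the deviation `D`, the exponent is `n (w |D| - w²
/ 2)`. If `|D| > w`, it is at least `n w² / 2 = 3 log T`. -/
theorem exists_le_weightedSum_of_not_isClean (hT : 2 ≤ T) {x : ℕ → ℝ}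
    (h : ¬ IsClean T L nrm ν x) :
    ∃ k < T, ∃ n < T, ∃ σ ∈ ({1, -1} : Finset ℝ), 3 * Real.log T ≤
      weightedSum T L nrm ν (firstPullsWeight T L nrm k n (σ * √(6 * Real.log T / n))) T x := by
  unfold IsClean at h
  push Not at h
  obtain ⟨t, ht, a, hp, hlt⟩ := h
  obtain ⟨k, hk, hw⟩ := exists_weightedSum_eq (ν := ν) ht hp
  have hlog := one_le_two_mul_log hT
  set n := (traj T L nrm x t).pulls a with hn
  set D := (traj T L nrm x t).empMean a - meanReward ν a with hD
  rw [ZoomState.width, ← hn] at hlt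
  set w := √(6 * Real.log T / n) with hwdef
  have hn0 : (0 : ℝ) < n := by exact_mod_cast Nat.pos_of_ne_zero hp
  have hw2 : n * w ^ 2 = 6 * Real.log T := by
    rw [hwdef, Real.sq_sqrt (div_nonneg (by linarith) hn0.le)]
    field_simp
  have hw0 : 0 ≤ w := Real.sqrt_nonneg _
  have key : ∃ σ ∈ ({1, -1} : Finset ℝ), σ * D = |D| := by
    rcases abs_choice D with h | h
    · exact ⟨1, by simp, by rw [h, one_mul]⟩
    · exact ⟨-1, by simp, by rw [h, neg_one_mul]⟩
  obtain ⟨σ, hσ, hσD⟩ := key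
  refine ⟨k, hk, n, (pulls_traj_le T L nrm x t a).trans_lt ht, σ, hσ, ?_⟩
  have hσ2 : σ ^ 2 = 1 := by
    rcases Finset.mem_insert.1 hσ with rfl | h
    · norm_num
    · rw [Finset.mem_singleton.1 h]; norm_num
  rw [hw]
  have h1 : (n : ℝ) * (w * w) ≤ n * (w * |D|) := by gcongr
  calc 3 * Real.log T ≤ n * (w * |D|) - n * w ^ 2 / 2 := by rw [hw2]; nlinarith
    _ = n * (w * (σ * D) - (σ ^ 2) * w ^ 2 / 2) := by rw [hσD, hσ2]; ring
    _ = _ := by ring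

variable {Ω : Type*} [MeasurableSpace Ω] {P : Measure Ω} [IsProbabilityMeasure P]
  {X : ℕ → Ω → ℝ}

/-- Cleanness quantifies over uncountably many arms; the finite union of deviation events is a
measurable set containing all failures. -/
theorem IsRewardProcess.exists_measurableSet_isClean (hX : IsRewardProcess P T L nrm ν X)
    (hν : IsLipschitzBandit L nrm ν) (hT : 2 ≤ T) :
    ∃ G : Set Ω, MeasurableSet G ∧ P.real G ≤ 2 / T ∧
      ∀ ω ∉ G, IsClean T L nrm ν fun s => X s ω := by
  set W : ℕ × ℕ × ℝ → Ω → ℝ := fun i ω => weightedSum T L nrm ν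
    (firstPullsWeight T L nrm i.1 i.2.1 (i.2.2 * √(6 * Real.log T / i.2.1))) T fun s => X s ω
    with hWdef
  have hWm : ∀ i, Measurable (W i) := fun i =>
    hX.measurable_comp le_rfl (measurable_weightedSum (measurable_firstPullsWeight _ _ _) T)
      fun x y h => weightedSum_congr (firstPullsWeight_congr _ _ _) h
  have hT0 : (0 : ℝ) < T := by positivity
  have hP : ∀ i, P {ω | 3 * Real.log T ≤ W i ω} ≤ ENNReal.ofReal (((T : ℝ) ^ 3)⁻¹) := by
    intro i
    have hmk := mul_meas_ge_le_lintegral (μ := P) (hWm i).exp.ennreal_ofReal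
      (ENNReal.ofReal ((T : ℝ) ^ 3))
    have h1 := hX.lintegral_exp_weightedSum_le hν
      (l := firstPullsWeight T L nrm i.1 i.2.1 (i.2.2 * √(6 * Real.log T / i.2.1)))
      (measurable_firstPullsWeight _ _ _) (firstPullsWeight_congr _ _ _) le_rfl
    have hsub : {ω | 3 * Real.log T ≤ W i ω} ⊆
        {ω | ENNReal.ofReal ((T : ℝ) ^ 3) ≤ ENNReal.ofReal (Real.exp (W i ω))} := by
      intro ω hω
      refine ENNReal.ofReal_le_ofReal ?_
      rw [← Real.log_le_iff_le_exp (by positivity), Real.log_pow]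
      exact_mod_cast hω
    have h2 := (mul_le_mul_right (measure_mono hsub) _).trans (hmk.trans h1)
    rw [ENNReal.ofReal_inv_of_pos (by positivity), ENNReal.le_inv_iff_mul_le, mul_comm]
    exact h2
  set I : Finset (ℕ × ℕ × ℝ) := Finset.range T ×ˢ Finset.range T ×ˢ {1, -1} with hI
  refine ⟨⋃ i ∈ I, {ω | 3 * Real.log T ≤ W i ω},
    Finset.measurableSet_biUnion _ fun i _ => measurableSet_le measurable_const (hWm i), ?_, ?_⟩
  · have hcard : I.card = T * (T * 2) := by
      rw [hI, Finset.card_product, Finset.card_product, Finset.card_range,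
        Finset.card_pair (by norm_num)]
    refine (measureReal_biUnion_finset_le I _).trans ?_
    calc _ ≤ I.card • ((T : ℝ) ^ 3)⁻¹ := Finset.sum_le_card_nsmul _ _ _ fun i _ =>
            ENNReal.toReal_le_of_le_ofReal (by positivity) (hP i)
      _ = 2 / T := by
            rw [hcard, nsmul_eq_mul]
            push_cast
            field_simp
  · intro ω hω
    by_contra hc
    obtain ⟨k, hk, n, hn, σ, hσ, hle⟩ := exists_le_weightedSum_of_not_isClean hT hc
    refine hω (Set.mem_biUnion (x := (k, n, σ)) ?_ hle)
    exact Finset.mem_coe.2 (Finset.mem_product.2 ⟨Finset.mem_range.2 hk,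
      Finset.mem_product.2 ⟨Finset.mem_range.2 hn, hσ⟩⟩)

end Clean

/-! ### The regret -/

section Regret

variable {M d : ℕ} {T : ℕ} {L : ℝ} {nrm : Seminorm ℝ (JointArm M d)}
  {ν : JointArm M d → Measure ℝ} {Ω : Type*} [MeasurableSpace Ω] {P : Measure Ω}
  [IsProbabilityMeasure P] {X : ℕ → Ω → ℝ}

theorem IsRewardProcess.integrable_gap (hX : IsRewardProcess P T L nrm ν X)
    (hν : IsLipschitzBandit L nrm ν) {t : ℕ} (ht : t < T) :
    Integrable (fun ω => gap ν (pulledArm T L nrm (fun s => X s ω) t)) P := by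
  refine Integrable.of_bound (hX.measurable_pulledArm ht.le (gap ν)).aestronglyMeasurable 1
    (Filter.Eventually.of_forall fun ω => ?_)
  have ha := pulledArm_mem_cube T L nrm (fun s => X s ω) t
  rw [Real.norm_of_nonneg (hν.gap_nonneg ha)]
  exact hν.gap_le_one ha

theorem IsRewardProcess.regret_eq (hX : IsRewardProcess P T L nrm ν X)
    (hν : IsLipschitzBandit L nrm ν) :
    regret P T ν X =
      ∫ ω, ∑ t ∈ Finset.range T, gap ν (pulledArm T L nrm (fun s => X s ω) t) ∂P := by
  rw [integral_finsetSum _ fun t ht => hX.integrable_gap hν (Finset.mem_range.1 ht), regret]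
  have h : ∀ t ∈ Finset.range T, ∫ ω, gap ν (pulledArm T L nrm (fun s => X s ω) t) ∂P =
      optMean ν - ∫ ω, X t ω ∂P := by
    intro t ht
    have ht := Finset.mem_range.1 ht
    have hm : Integrable (fun ω => meanReward ν (pulledArm T L nrm (fun s => X s ω) t)) P := by
      refine ((integrable_const (optMean ν)).sub (hX.integrable_gap hν ht)).congr
        (Filter.Eventually.of_forall fun ω => ?_)
      simp [gap]
    rw [hX.integral_eq hν ht]
    simp only [armAt_eq_pulledArm, gap]
    rw [integral_sub (integrable_const _) hm]
    simp
  rw [Finset.sum_congr rfl h, Finset.sum_sub_distrib]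
  simp

/-- An unclean run costs at most `T g` and has probability at most `2 / T`. The bound `g` on the
gaps is kept as a parameter because 1 would be too large when `c` is small. -/
theorem IsRewardProcess.regret_le (hX : IsRewardProcess P T L nrm ν X)
    (hν : IsLipschitzBandit L nrm ν) (hT : 2 ≤ T) {B g : ℝ} (hB : 0 ≤ B)
    (hg : ∀ a ∈ cube M d, gap ν a ≤ g)
    (hclean : ∀ x, IsClean T L nrm ν x →
      ∑ t ∈ Finset.range T, gap ν (pulledArm T L nrm x t) ≤ B) :
    regret P T ν X ≤ B + 2 * g := by
  obtain ⟨G, hGm, hPG, hG⟩ := hX.exists_measurableSet_isClean hν hT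
  have hT0 : (0 : ℝ) < T := by positivity
  have hg0 : 0 ≤ g := by
    have ha := pulledArm_mem_cube T L nrm (fun _ => 0) 0
    exact (hν.gap_nonneg ha).trans (hg _ ha)
  rw [hX.regret_eq hν]
  calc _ ≤ ∫ ω, (B + G.indicator (fun _ => T * g) ω) ∂P := by
        refine integral_mono (integrable_finsetSum _ fun t ht =>
          hX.integrable_gap hν (Finset.mem_range.1 ht))
          ((integrable_const B).add ((integrable_const _).indicator hGm)) fun ω => ?_
        by_cases hω : ω ∈ G
        · simp only [Set.indicator_of_mem hω]
          have := Finset.sum_le_card_nsmul (Finset.range T)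
            (fun t => gap ν (pulledArm T L nrm (fun s => X s ω) t)) g
            fun t _ => hg _ (pulledArm_mem_cube _ _ _ _ _)
          rw [Finset.card_range, nsmul_eq_mul] at this
          linarith
        · simp only [Set.indicator_of_notMem hω, add_zero]
          exact hclean _ (hG ω hω)
    _ = B + P.real G * (T * g) := by
        rw [integral_add (integrable_const B) ((integrable_const _).indicator hGm),
          integral_indicator_const _ hGm]
        simp
    _ ≤ B + 2 / T * (T * g) := by gcongr
    _ = B + 2 * g := by field_simp

/-- Since gaps are at most 1, `Δ ^ (M d + 2) ≤ Δ ^ (M d) ≤ c ≤ 2 c log T`. This puts the cost of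
unclean runs on the scale of the claimed bound. -/
theorem IsZoomingMultiplier.gap_le_rpow {c : ℝ} (hc : IsZoomingMultiplier L nrm ν c)
    (hν : IsLipschitzBandit L nrm ν) (hT : 2 ≤ T) {a : JointArm M d} (ha : a ∈ cube M d) :
    gap ν a ≤ (2 * (c * Real.log T)) ^ ((1 : ℝ) / ((M * d : ℕ) + 2 : ℝ)) := by
  have hlog := one_le_two_mul_log hT
  have hc0 := hc.nonneg
  have hle : c ≤ 2 * (c * Real.log T) := by nlinarith
  have h0 := hν.gap_nonneg ha
  rcases h0.eq_or_lt with h | h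
  · rw [← h]
    exact Real.rpow_nonneg (hc0.trans hle) _
  · have h1 : gap ν a ^ (M * d + 2) ≤ 2 * (c * Real.log T) :=
      (pow_le_pow_of_le_one h0 (hν.gap_le_one ha) (Nat.le_add_right _ _)).trans
        ((hc.gap_pow_le ha h).trans hle)
    calc gap ν a = (gap ν a ^ (M * d + 2)) ^ ((1 : ℝ) / ((M * d : ℕ) + 2 : ℝ)) := by
          rw [one_div, show ((M * d : ℕ) + 2 : ℝ) = ((M * d + 2 : ℕ) : ℝ) by push_cast; ring,
            Real.pow_rpow_inv_natCast h0 (by omega)]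
      _ ≤ _ := Real.rpow_le_rpow (by positivity) h1 (by positivity)

end Regret

end

theorem mainTheorem4 :
    ∃ K : ℝ, 0 < K ∧
      ∀ (M d : ℕ), 1 ≤ M → 1 ≤ d →
      ∀ (L : ℝ), 0 < L →
      ∀ (nrm : Seminorm ℝ (JointArm M d)), (∀ x, nrm x = 0 → x = 0) →
      ∀ (ν : JointArm M d → Measure ℝ), IsLipschitzBandit L nrm ν →
      ∀ (c : ℝ), IsZoomingMultiplier L nrm ν c →
      ∀ (T : ℕ), 2 ≤ T →
      ∀ (Ω : Type*) [MeasurableSpace Ω] (P : Measure Ω) [IsProbabilityMeasure P]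
        (X : ℕ → Ω → ℝ), IsRewardProcess P T L nrm ν X →
        (∀ t < T, Integrable (X t) P) ∧
          regret P T ν X ≤
            K * (T : ℝ) ^ (((M * d : ℕ) + 1 : ℝ) / ((M * d : ℕ) + 2 : ℝ)) *
              (c * Real.log T) ^ ((1 : ℝ) / ((M * d : ℕ) + 2 : ℝ)) := by
  -- In units of `δ T`: 3 / 2 from small gaps, 152 from the slices, and 4 from unclean runs, rounded
  -- up.
  refine ⟨158, by norm_num, ?_⟩
  intro M d _ _ L hL nrm _ ν hν c hc T hT Ω _ P _ X hX
  refine ⟨fun t ht => hX.integrable hν ht, ?_⟩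
  have hlog := one_le_two_mul_log hT
  have hgap := fun (a : JointArm M d) (ha : a ∈ cube M d) => hc.gap_le_rpow hν hT ha
  have hT1 : (1 : ℝ) ≤ T := by exact_mod_cast (one_le_two.trans hT)
  have hT0 : (0 : ℝ) < T := by linarith
  generalize hDdef : M * d = D at hgap ⊢
  set p : ℝ := (1 : ℝ) / ((D : ℝ) + 2) with hp
  have hD2 : (0 : ℝ) < (D : ℝ) + 2 := by positivity
  have hp0 : 0 < p := by positivity
  have hp1 : p ≤ 1 := by
    rw [hp, div_le_one hD2]
    linarith [(Nat.cast_nonneg D : (0 : ℝ) ≤ D)]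
  have hq : ((D : ℝ) + 1) / ((D : ℝ) + 2) = 1 - p := by rw [hp]; field_simp; ring
  rw [hq]
  have hcl : 0 ≤ c * Real.log T := mul_nonneg hc.nonneg (by linarith)
  have hTq : 1 ≤ (T : ℝ) ^ (1 - p) := Real.one_le_rpow hT1 (by linarith)
  have hg2 : (2 * (c * Real.log T)) ^ p ≤ 2 * (c * Real.log T) ^ p := by
    rw [Real.mul_rpow two_pos.le hcl]
    have : (2 : ℝ) ^ p ≤ 2 := by
      simpa using Real.rpow_le_rpow_of_exponent_le (one_le_two (α := ℝ)) hp1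
    exact mul_le_mul_of_nonneg_right this (Real.rpow_nonneg hcl _)
  -- If `c = 0`, the threshold `δ` would vanish; but then every gap is zero and so is the bound.
  rcases hcl.eq_or_lt with h0 | hpos
  · have hg : ∀ a ∈ cube M d, gap ν a ≤ 0 := fun a ha => by
      have := hgap a ha
      rwa [← h0, mul_zero, Real.zero_rpow hp0.ne'] at this
    rw [← h0, Real.zero_rpow hp0.ne', mul_zero]
    have := hX.regret_le hν hT le_rfl hg fun x _ => Finset.sum_nonpos fun t _ =>
      hg _ (pulledArm_mem_cube _ _ _ _ _)
    simpa using this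
  -- This `δ` solves `c log T / δ ^ (D + 1) = δ T`, which balances the two terms of `sum_gap_le`.
  · set δ : ℝ := (c * Real.log T / T) ^ p with hδ
    have hδ0 : 0 < δ := Real.rpow_pos_of_pos (by positivity) _
    have hδT : δ * T = (T : ℝ) ^ (1 - p) * (c * Real.log T) ^ p := by
      rw [hδ, Real.div_rpow hcl hT0.le, Real.rpow_sub hT0, Real.rpow_one]
      field_simp
    have hδpow : δ ^ (D + 1) * δ = c * Real.log T / T := by
      rw [← pow_succ, hδ, hp, one_div, show (D : ℝ) + 2 = ((D + 1 + 1 : ℕ) : ℝ) by push_cast; ring]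
      exact Real.rpow_inv_natCast_pow (by positivity) (by omega)
    have hsecond : 152 * (c * Real.log T) / δ ^ (D + 1) = 152 * (δ * T) := by
      rw [eq_div_iff hT0.ne'] at hδpow
      rw [div_eq_iff (by positivity), ← hδpow]
      ring
    have hreg := hX.regret_le (B := 3 / 2 * δ * T + 152 * (c * Real.log T) / δ ^ (D + 1)) hν hT
      (by positivity) hgap fun x hx => by
        have := hx.sum_gap_le hν hL hT hc hδ0
        rwa [hDdef] at this
    have hlast : (c * Real.log T) ^ p ≤ δ * T := by
      rw [hδT]
      exact le_mul_of_one_le_left (Real.rpow_nonneg hcl _) hTq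
    rw [hsecond] at hreg
    rw [mul_assoc, ← hδT]
    have : 0 < δ * T := by positivity
    linarith
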